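/- Let $\Lambda\ge 0$. All Hilbert spaces are finite-dimensional and complex. **Protocols.** For $n$ even, an $n$-message $\Lambda$-penWCF protocol consists of spaces $\mathcal A$ (Alice), $\mathcal M$ (message), $\mathcal B$ (Bob); unit vectors $\psi_A\in\mathcal A$, $\psi_M\in\mathcal M$, $\psi_B\in\mathcal B$; for each round $i=1,\dots,n$ a projector $E_i$ and a unitary $U_i$, both acting on $\mathcal A\otimes\mathcal M$ if $i$ is odd and on $\mathcal M\otimes\mathcal B$ if $i$ is even; and POVMs $\{\Pi_A^{(0)},\Pi_A^{(1)},\Pi_A^{(\bot)}\}$ on $\mathcal A$ and $\{\Pi_B^{(0)},\Pi_B^{(1)},\Pi_B^{(\bot)}\}$ on $\mathcal B$. Initially Alice holds $\psi_A\otimes\psi_M$ and Bob holds $\psi_B$. In round $i$ Alice ($i$ odd) or Bob ($i$ even) measures $\{E_i,\mathbb I-E_i\}$, outputs $\bot$ and stops on the second outcome, and otherwise applies $U_i$ and sends the message register to the other party. After round $n$ both measure their POVMs and output the results. Put $\psi_0=\psi_A\otimes\psi_M\otimes\psi_B$ and $\psi_i=U_iU_{i-1}\cdots U_1\psi_0$.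 It is required that $E_i\psi_{i-1}=\psi_{i-1}$ for $1\le i\le n$, that $(\Pi_A^{(a)}\otimes\mathbb I\otimes\Pi_B^{(b)})\psi_n=0$ for all $a,b\in\{0,1,\bot\}$ except $a=b\in\{0,1\}$, and that $\|(\Pi_A^{(x)}\otimes\mathbb I\otimes\Pi_B^{(x)})\psi_n\|^2=\tfrac12$ for $x\in\{0,1\}$. **Cheating rewards.** A cheating Alice facing honest Bob gets $\Lambda+1$ points if Bob outputs $0$, $\Lambda$ points if he outputs $1$, and $0$ points if he outputs $\bot$; $R_A^*$ is the supremum of her expected number of points over all strategies, that is, over all finite-dimensional private workspaces, initial states of her workspace and the message, and quantum channels applied to these in the odd rounds. A cheating Bob facing honest Alice gets $\Lambda+1$ points if Alice outputs $1$, $\Lambda$ points if she outputs $0$, and $0$ points if she outputs $\bot$; $R_B^*$ is the supremum of his expected number of points over all private workspaces, initial states of the workspace, and quantum channels applied to message and workspace in the even rounds. **Point games.** For a positive semidefinite matrix $Z$, a vector $\psi$ (not necessarily normalised) and $z\ge0$, let $\mathsf{Prob}[Z,\psi](z)=\langle\psi|\Pi^{[z]}|\psi\rangle$, where $\Pi^{[z]}$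 is the orthogonal projector onto the $z$-eigenspace of $Z$ (zero if $z$ is not an eigenvalue). For finitely supported $g,h:\mathbb R_{\ge0}\to\mathbb R_{\ge0}$, the line transition $g\to h$ is EBM if there are matrices $0\le G\le H$ and a vector $\psi$ with $g=\mathsf{Prob}[G,\psi]$ and $h=\mathsf{Prob}[H,\psi]$. For finitely supported $p,q:\mathbb R_{\ge0}^2\to\mathbb R_{\ge0}$, the transition $p\to q$ is EBM horizontal if $p(\cdot,y)\to q(\cdot,y)$ is EBM for every $y\ge0$, and EBM vertical if $p(x,\cdot)\to q(x,\cdot)$ is EBM for every $x\ge0$. Write $[\![x,y]\!]$ for the function equal to $1$ at $(x,y)$ and $0$ elsewhere. A $\Lambda$-penEBM point game with final point $[\![\beta,\alpha]\!]$ is a finite sequence $(p_0,\dots,p_m)$ of finitely supported functions $\mathbb R_{\ge0}^2\to\mathbb R_{\ge0}$ with $p_0=\tfrac12[\![\Lambda,\Lambda+1]\!]+\tfrac12[\![\Lambda+1,\Lambda]\!]$, with $p_i\to p_{i+1}$ EBM vertical for even $i$ and EBM horizontal for odd $i$ ($0\le i<m$), and with $p_m=[\![\beta,\alpha]\!]$,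 where $\alpha,\beta\ge\Lambda$. **Proposition.** For every $\Lambda$-penWCF protocol with cheating rewards $R_A^*$, $R_B^*$ and every $\delta>0$ there is a $\Lambda$-penEBM point game with final point $[\![R_A^*+\delta,\,R_B^*+\delta]\!]$. -/

import Mathlib

open scoped NNReal Kronecker ComplexOrder

noncomputable section

namespace PenWCF

/-! ### Cheat-penalised weak coin flipping protocols

Alice's workspace, the message space and Bob's workspace are `ℂ^A`, `ℂ^M` and `ℂ^B` for finite
index types `A`, `M`, `B`; vectors and operators are written in these orthonormal bases.
The joint space has index type `A × M × B`. -/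

/-- Squared Euclidean norm of a vector. -/
def sqNorm {ι : Type} [Fintype ι] (v : ι → ℂ) : ℝ := ∑ i, ‖v i‖ ^ 2

/-- `|v⟩⟨v|`. -/
def ketbra {ι : Type} (v : ι → ℂ) : Matrix ι ι ℂ := Matrix.vecMulVec v (star v)

/-- Density operators. -/
def IsDensity {ι : Type} [Fintype ι] (ρ : Matrix ι ι ℂ) : Prop :=
  ρ.PosSemidef ∧ ρ.trace = 1

/-- `X ⊗ 𝟙_B` for an operator `X` on the first two tensor factors. -/
def onAM {A M : Type} (B : Type) [DecidableEq B] (X : Matrix (A × M) (A × M) ℂ) :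
    Matrix (A × M × B) (A × M × B) ℂ :=
  Matrix.reindex (Equiv.prodAssoc A M B) (Equiv.prodAssoc A M B) (X ⊗ₖ (1 : Matrix B B ℂ))

/-- `𝟙_A ⊗ Y` for an operator `Y` on the last two tensor factors. -/
def onMB (A : Type) {M B : Type} [DecidableEq A] (Y : Matrix (M × B) (M × B) ℂ) :
    Matrix (A × M × B) (A × M × B) ℂ :=
  (1 : Matrix A A ℂ) ⊗ₖ Y

/-- `X ⊗ 𝟙_M ⊗ Y`. -/
def onAB {A : Type} (M : Type) {B : Type} [DecidableEq M] (X : Matrix A A ℂ) (Y : Matrix B B ℂ) :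
    Matrix (A × M × B) (A × M × B) ℂ :=
  X ⊗ₖ ((1 : Matrix M M ℂ) ⊗ₖ Y)

/-- Outcomes: `some 0`, `some 1`, and `none` for `⊥` (cheating detected). -/
abbrev Outcome : Type := Option (Fin 2)

/-- Positive operator-valued measures with outcomes `0`, `1`, `⊥`. -/
def IsPOVM {ι : Type} [Fintype ι] [DecidableEq ι] (P : Outcome → Matrix ι ι ℂ) : Prop :=
  (∀ a, (P a).PosSemidef) ∧ ∑ a, P a = 1

/-- The data of an `n`-message protocol. In round `i` (`1 ≤ i ≤ n`) Alice acts if `i` is odd and Bob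
acts if `i` is even: the acting party first measures `{E_i, 𝟙 - E_i}` on their workspace and the
message, outputs `⊥` and stops on the second outcome, and otherwise applies `U_i` and sends the
message to the other party. Here `E_i`, `U_i` are `EA i`, `UA i` for odd `i` and `EB i`, `UB i` for
even `i`; the other values of these functions are not used. -/
structure Protocol (A M B : Type) where
  /-- number of messages -/
  n : ℕ
  /-- initial vector of Alice -/
  psiA : A → ℂ
  /-- initial vector of the message (held by Alice before round `1`) -/
  psiM : M → ℂ
  /-- initial vector of Bob -/
  psiB : B → ℂ
  UA : ℕ → Matrix (A × M) (A × M) ℂ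
  EA : ℕ → Matrix (A × M) (A × M) ℂ
  UB : ℕ → Matrix (M × B) (M × B) ℂ
  EB : ℕ → Matrix (M × B) (M × B) ℂ
  /-- final measurement of Alice -/
  PiA : Outcome → Matrix A A ℂ
  /-- final measurement of Bob -/
  PiB : Outcome → Matrix B B ℂ

/-- Quantum channels on `ℂ^H`, in Kraus form. -/
structure Channel (H : Type) [Fintype H] [DecidableEq H] where
  rank : ℕ
  kraus : Fin rank → Matrix H H ℂ
  complete : ∑ j, (kraus j).conjTranspose * kraus j = 1

namespace Protocol

variable {A M B : Type} [Fintype A] [DecidableEq A] [Fintype M] [DecidableEq M]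
  [Fintype B] [DecidableEq B] (P : Protocol A M B)

/-- `U_i` on the joint space. -/
def U (i : ℕ) : Matrix (A × M × B) (A × M × B) ℂ :=
  if Odd i then onAM B (P.UA i) else onMB A (P.UB i)

/-- `E_i` on the joint space. -/
def E (i : ℕ) : Matrix (A × M × B) (A × M × B) ℂ :=
  if Odd i then onAM B (P.EA i) else onMB A (P.EB i)

/-- The honest states `ψ_0 = ψ_A ⊗ ψ_M ⊗ ψ_B` and `ψ_i = U_i ⋯ U_1 ψ_0`. -/
def honest : ℕ → (A × M × B → ℂ)
  | 0 => fun x => P.psiA x.1 * P.psiM x.2.1 * P.psiB x.2.2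
  | i + 1 => (P.U (i + 1)).mulVec (honest i)

/-- `P` is a penalised weak coin flipping protocol. -/
structure IsPenWCF : Prop where
  even_n : Even P.n
  norm_psiA : sqNorm P.psiA = 1
  norm_psiM : sqNorm P.psiM = 1
  norm_psiB : sqNorm P.psiB = 1
  unitary_UA : ∀ i, 1 ≤ i → i ≤ P.n → Odd i → P.UA i ∈ Matrix.unitaryGroup (A × M) ℂ
  unitary_UB : ∀ i, 1 ≤ i → i ≤ P.n → Even i → P.UB i ∈ Matrix.unitaryGroup (M × B) ℂ
  proj_EA : ∀ i, 1 ≤ i → i ≤ P.n → Odd i → IsStarProjection (P.EA i)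
  proj_EB : ∀ i, 1 ≤ i → i ≤ P.n → Even i → IsStarProjection (P.EB i)
  /-- the checks never fail in an honest run -/
  honest_E : ∀ i, i < P.n → (P.E (i + 1)).mulVec (P.honest i) = P.honest i
  povm_A : IsPOVM P.PiA
  povm_B : IsPOVM P.PiB
  /-- in an honest run nobody outputs `⊥` and the two outputs agree -/
  correct : ∀ a b : Outcome, ¬ (a = b ∧ a ≠ none) →
    (onAB M (P.PiA a) (P.PiB b)).mulVec (P.honest P.n) = 0
  /-- in an honest run each of the outputs `0`, `1` has probability `1 / 2` -/
  balanced : ∀ x : Fin 2,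
    sqNorm ((onAB M (P.PiA (some x)) (P.PiB (some x))).mulVec (P.honest P.n)) = 1 / 2

/-- Cheating strategies of Bob with private workspace `ℂ^W`: an initial state of the workspace and,
for every even round, a quantum channel on the message and the workspace. -/
structure BobStrategy (M W : Type) [Fintype M] [DecidableEq M] [Fintype W] [DecidableEq W] where
  init : Matrix W W ℂ
  density : IsDensity init
  act : ℕ → Channel (M × W)

/-- Cheating strategies of Alice with private workspace `ℂ^W`: an initial state of the workspace and
the message and, for every odd round, a quantum channel on the workspace and the message. -/
structure AliceStrategy (M W : Type) [Fintype M] [DecidableEq M] [Fintype W] [DecidableEq W] where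
  init : Matrix (W × M) (W × M) ℂ
  density : IsDensity init
  act : ℕ → Channel (W × M)

section Cheating

variable {W : Type} [Fintype W] [DecidableEq W]

/-- The state after `i` rounds of honest Alice against cheating Bob, restricted to the event that
Alice has not yet output `⊥` (so its trace is the probability of that event). -/
def bobCheatState (S : BobStrategy M W) : ℕ → Matrix (A × M × W) (A × M × W) ℂ
  | 0 => ketbra P.psiA ⊗ₖ (ketbra P.psiM ⊗ₖ S.init)
  | i + 1 =>
    if Odd (i + 1) then
      onAM W (P.UA (i + 1) * P.EA (i + 1)) * bobCheatState S i *
        (onAM W (P.UA (i + 1) * P.EA (i + 1))).conjTranspose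
    else
      ∑ j, onMB A ((S.act (i + 1)).kraus j) * bobCheatState S i *
        (onMB A ((S.act (i + 1)).kraus j)).conjTranspose

/-- The state after `i` rounds of cheating Alice against honest Bob, restricted to the event that
Bob has not yet output `⊥`. -/
def aliceCheatState (S : AliceStrategy M W) : ℕ → Matrix (W × M × B) (W × M × B) ℂ
  | 0 => Matrix.reindex (Equiv.prodAssoc W M B) (Equiv.prodAssoc W M B)
      (S.init ⊗ₖ ketbra P.psiB)
  | i + 1 =>
    if Odd (i + 1) then
      ∑ j, onAM B ((S.act (i + 1)).kraus j) * aliceCheatState S i *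
        (onAM B ((S.act (i + 1)).kraus j)).conjTranspose
    else
      onMB W (P.UB (i + 1) * P.EB (i + 1)) * aliceCheatState S i *
        (onMB W (P.UB (i + 1) * P.EB (i + 1))).conjTranspose

/-- Expected number of points of cheating Bob: `Λ + 1` if Alice outputs `1`, `Λ` if she outputs `0`,
and `0` if she outputs `⊥` (in some round or at the end). -/
def bobReward (Λ : ℝ≥0) (S : BobStrategy M W) : ℝ :=
  (Λ + 1) * (onAB M (P.PiA (some 1)) (1 : Matrix W W ℂ) * P.bobCheatState S P.n).trace.re +
    Λ * (onAB M (P.PiA (some 0)) (1 : Matrix W W ℂ) * P.bobCheatState S P.n).trace.re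

/-- Expected number of points of cheating Alice: `Λ + 1` if Bob outputs `0`, `Λ` if he outputs `1`,
and `0` if he outputs `⊥` (in some round or at the end). -/
def aliceReward (Λ : ℝ≥0) (S : AliceStrategy M W) : ℝ :=
  (Λ + 1) * (onAB M (1 : Matrix W W ℂ) (P.PiB (some 0)) * P.aliceCheatState S P.n).trace.re +
    Λ * (onAB M (1 : Matrix W W ℂ) (P.PiB (some 1)) * P.aliceCheatState S P.n).trace.re

end Cheating

/-- The cheating reward `R_A^*`, over all finite-dimensional workspaces and all strategies. -/
def cheatingRewardA (Λ : ℝ≥0) : ℝ :=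
  sSup {r | ∃ (W : Type) (_ : Fintype W) (_ : DecidableEq W) (S : AliceStrategy M W),
    r = P.aliceReward Λ S}

/-- The cheating reward `R_B^*`, over all finite-dimensional workspaces and all strategies. -/
def cheatingRewardB (Λ : ℝ≥0) : ℝ :=
  sSup {r | ∃ (W : Type) (_ : Fintype W) (_ : DecidableEq W) (S : BobStrategy M W),
    r = P.bobReward Λ S}

end Protocol

/-! ### Point games expressible by matrices -/

/-- `Prob[Z, ψ](z) = ⟨ψ|Π^{[z]}|ψ⟩`, where `Π^{[z]}` is the orthogonal projector onto the eigenspace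
of `Z` for `z` (so the value is `0` if `z` is not an eigenvalue). -/
def prob {ι : Type} [Fintype ι] [DecidableEq ι] (Z : Matrix ι ι ℂ) (ψ : EuclideanSpace ℂ ι)
    (z : ℝ≥0) : ℝ :=
  (inner ℂ ψ ((Module.End.eigenspace (Matrix.toEuclideanLin Z) ((z : ℝ) : ℂ)).starProjection ψ)).re

/-- The line transition `g → h` is expressible by matrices. -/
def IsEBMLine (g h : ℝ≥0 → ℝ≥0) : Prop :=
  ∃ (ι : Type) (_ : Fintype ι) (_ : DecidableEq ι) (G H : Matrix ι ι ℂ) (ψ : EuclideanSpace ℂ ι),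
    G.PosSemidef ∧ (H - G).PosSemidef ∧
      (∀ z, (g z : ℝ) = prob G ψ z) ∧ (∀ z, (h z : ℝ) = prob H ψ z)

/-- Frames: finitely supported functions `ℝ≥0 × ℝ≥0 → ℝ≥0`. -/
abbrev Frame : Type := (ℝ≥0 × ℝ≥0) →₀ ℝ≥0

/-- The frame `w · ⟦x, y⟧`. -/
def point (w x y : ℝ≥0) : Frame := Finsupp.single (x, y) w

/-- EBM horizontal transitions. -/
def IsEBMHorizontal (p q : Frame) : Prop :=
  ∀ y : ℝ≥0, IsEBMLine (fun x => p (x, y)) (fun x => q (x, y))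

/-- EBM vertical transitions. -/
def IsEBMVertical (p q : Frame) : Prop :=
  ∀ x : ℝ≥0, IsEBMLine (fun y => p (x, y)) (fun y => q (x, y))

/-- `(p 0, …, p n)` is a `Λ`-penalty EBM point game with final point `⟦β, α⟧`. -/
structure IsPenEBMPointGame (Λ : ℝ≥0) (n : ℕ) (p : ℕ → Frame) (β α : ℝ≥0) : Prop where
  first : p 0 = point (1 / 2) Λ (Λ + 1) + point (1 / 2) (Λ + 1) Λ
  vertical : ∀ i, i < n → Even i → IsEBMVertical (p i) (p (i + 1))
  horizontal : ∀ i, i < n → Odd i → IsEBMHorizontal (p i) (p (i + 1))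
  last : p n = point 1 β α
  le_fst : Λ ≤ β
  le_snd : Λ ≤ α

end PenWCF

end

namespace PenWCF

open Matrix

/-! ### Eigenprojections -/

/-! The argument is semidefinite duality followed by reading the protocol backwards. Fix honest
Alice. A cheating Bob controls only which states on Alice's workspace and the message are compatible
with Alice's reduced state, so his best reward is a semidefinite program. A dual solution is a
sequence of positive operators `Z j` on Alice's workspace that ends in her reward operator and
satisfies `Z j ⊗ 1 > E U* (Z (j+1) ⊗ 1) U E` at each of her rounds after the first; its value is an
expectation after round 1. For every `r > R_B^*` there is one of value below `r`
(`exists_dual_alice`), and symmetrically for honest Bob (`exists_dual_bob`). Strong duality is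
proved by induction on the rounds. One round is a Hahn–Banach separation
(`exists_posSemidef_of_forall_le`), and the resulting state is realised by a unitary of the cheater
acting on a purification (`exists_unitary_reduced_eq`).

Given both certificates, let `X i` and `Y i` be Bob's and Alice's dual operators on the joint space.
They commute, so the honest state `ψ_i` has a joint spectral distribution, its `frame`. A round
changes only one of the two operators, and its unitary and check commute with the other, so from
after to before the round the frame moves along lines in one coordinate. The dual inequality
involves the check `E`, but `E ψ = ψ` and strictness allow a dilation that turns it into an honest
inequality `G ≤ H` (`isEBMLine_of_posDef`).

At time `n` the perfect correlation of the outputs makes the two components of `ψ_n` joint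
eigenvectors of the reward operators, which gives the prescribed first frame (`honest_final`). At
time `0`, strictness of the dual value permits replacing the operators by the scalars `α` and `β`
(`smul_one_sub_ketbra_posDef`), so the frame collapses to one point. -/

/-- The orthogonal projection onto the `z`-eigenspace of `Z`. -/
noncomputable def eigProj {ι : Type} [Fintype ι] [DecidableEq ι] (Z : Matrix ι ι ℂ) (z : ℝ≥0) :
    EuclideanSpace ℂ ι →L[ℂ] EuclideanSpace ℂ ι :=
  (Module.End.eigenspace (Matrix.toEuclideanLin Z) ((z : ℝ) : ℂ)).starProjection

section Spectral

variable {ι κ : Type} [Fintype ι] [DecidableEq ι] [Fintype κ] [DecidableEq κ]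

lemma toEuclideanLin_mul {l : Type} [Fintype l] [DecidableEq l] (X : Matrix l ι ℂ)
    (Y : Matrix ι κ ℂ) (v : EuclideanSpace ℂ κ) :
    toEuclideanLin (X * Y) v = toEuclideanLin X (toEuclideanLin Y v) := by
  simp [toLpLin_apply, mulVec_mulVec]

lemma norm_toEuclideanLin_of_isometry {T : Matrix κ ι ℂ} (hT : Tᴴ * T = 1)
    (v : EuclideanSpace ℂ ι) : ‖toEuclideanLin T v‖ = ‖v‖ := by
  have h1 : inner ℂ (toEuclideanLin T v) (toEuclideanLin T v) = inner ℂ v v := by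
    rw [← LinearMap.adjoint_inner_left, ← toEuclideanLin_conjTranspose_eq_adjoint,
      ← toEuclideanLin_mul, hT]
    simp
  rw [inner_self_eq_norm_sq_to_K, inner_self_eq_norm_sq_to_K] at h1
  exact (pow_left_inj₀ (norm_nonneg _) (norm_nonneg _) two_ne_zero).1 (by exact_mod_cast h1)

lemma prob_eq_norm_sq (Z : Matrix ι ι ℂ) (ψ : EuclideanSpace ℂ ι) (z : ℝ≥0) :
    prob Z ψ z = ‖eigProj Z z ψ‖ ^ 2 := by
  have h := Submodule.starProjection_inner_eq_zero
    (K := Module.End.eigenspace (toEuclideanLin Z) ((z : ℝ) : ℂ)) ψ _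
    (Submodule.starProjection_apply_mem _ ψ)
  rw [inner_sub_left, sub_eq_zero] at h
  rw [prob, h, eigProj, inner_self_eq_norm_sq_to_K]
  norm_cast

/-- Any operator that intertwines two symmetric operators intertwines their eigenprojections. -/
lemma map_starProjection_eigenspace {E F : Type*} [NormedAddCommGroup E] [InnerProductSpace ℂ E]
    [FiniteDimensional ℂ E] [NormedAddCommGroup F] [InnerProductSpace ℂ F] [FiniteDimensional ℂ F]
    {S : E →ₗ[ℂ] E} {R : F →ₗ[ℂ] F} (hS : S.IsSymmetric) (hR : R.IsSymmetric) (T : E →ₗ[ℂ] F)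
    (hT : ∀ v, T (S v) = R (T v)) (μ : ℂ) (v : E) :
    T ((Module.End.eigenspace S μ).starProjection v) =
      (Module.End.eigenspace R μ).starProjection (T v) := by
  refine (Submodule.eq_starProjection_of_mem_of_inner_eq_zero ?_ ?_).symm
  · rw [Module.End.mem_eigenspace_iff, ← hT]
    have := Submodule.starProjection_apply_mem (Module.End.eigenspace S μ) v
    rw [Module.End.mem_eigenspace_iff] at this
    rw [this, map_smul]
  · intro w hw
    -- The adjoint of `T` also intertwines, so it maps the `μ`-eigenspace of `R` into that of `S`,
    -- to which `v - Pv` is orthogonal.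
    rw [← map_sub, ← LinearMap.adjoint_inner_right]
    refine Submodule.starProjection_inner_eq_zero v _ ?_
    rw [Module.End.mem_eigenspace_iff] at hw ⊢
    rw [← map_smul, ← hw]
    refine ext_inner_left ℂ fun u => ?_
    rw [LinearMap.adjoint_inner_right, ← hS, LinearMap.adjoint_inner_right, hT, hR]

lemma eigProj_intertwine {X : Matrix ι ι ℂ} {Y : Matrix κ κ ℂ} (hX : X.IsHermitian)
    (hY : Y.IsHermitian) (T : Matrix κ ι ℂ) (hT : T * X = Y * T) (z : ℝ≥0)
    (v : EuclideanSpace ℂ ι) :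
    toEuclideanLin T (eigProj X z v) = eigProj Y z (toEuclideanLin T v) := by
  refine map_starProjection_eigenspace (isSymmetric_toEuclideanLin_iff.2 hX)
    (isSymmetric_toEuclideanLin_iff.2 hY) _ (fun v => ?_) _ _
  rw [← toEuclideanLin_mul, hT, toEuclideanLin_mul]

/-- The eigenprojections of commuting Hermitian matrices commute. -/
lemma eigProj_comm {X Y : Matrix ι ι ℂ} (hX : X.IsHermitian) (hY : Y.IsHermitian)
    (h : X * Y = Y * X) (x y : ℝ≥0) (v : EuclideanSpace ℂ ι) :
    eigProj X x (eigProj Y y v) = eigProj Y y (eigProj X x v) := by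
  -- The intertwiner here is the eigenprojection of `X` itself, which commutes with `Y`.
  refine map_starProjection_eigenspace (isSymmetric_toEuclideanLin_iff.2 hY)
    (isSymmetric_toEuclideanLin_iff.2 hY) (eigProj X x : EuclideanSpace ℂ ι →ₗ[ℂ] _)
    (fun v => ?_) _ _
  exact (eigProj_intertwine hX hX Y h.symm x v).symm

/-- Eigenvectors are fixed or killed by eigenprojections. -/
lemma eigProj_of_eigenvector {X : Matrix ι ι ℂ} (hX : X.IsHermitian) {v : EuclideanSpace ℂ ι}
    {a : ℝ≥0} (hv : toEuclideanLin X v = ((a : ℝ) : ℂ) • v) (z : ℝ≥0) :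
    eigProj X z v = if z = a then v else 0 := by
  split_ifs with h
  · subst h
    exact Submodule.starProjection_eq_self_iff.2 (Module.End.mem_eigenspace_iff.2 hv)
  · refine (Submodule.starProjection_apply_eq_zero_iff _).2 ?_
    have := (isSymmetric_toEuclideanLin_iff.2 hX).orthogonalFamily_eigenspaces
    have h2 := this.isOrtho (i := ((a : ℝ) : ℂ)) (j := ((z : ℝ) : ℂ)) (by
      intro h'; apply h; exact_mod_cast h'.symm)
    exact h2 (Module.End.mem_eigenspace_iff.2 hv)

lemma finite_eigProj_ne_zero (X : Matrix ι ι ℂ) : {z : ℝ≥0 | eigProj X z ≠ 0}.Finite := by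
  have h := Module.End.finite_hasEigenvalue (toEuclideanLin X)
  refine Set.Finite.subset (h.preimage (f := fun z : ℝ≥0 => ((z : ℝ) : ℂ)) ?_) ?_
  · intro a _ b _ hab
    simpa using hab
  · intro z hz hz'
    apply hz
    change Module.End.eigenspace _ ((z : ℝ) : ℂ) = ⊥ at hz'
    simp only [eigProj, hz', Submodule.starProjection_bot]

lemma exists_smul_one_sub_posSemidef {Q : Matrix ι ι ℂ} (hQ : Q.IsHermitian) :
    ∃ c : ℝ, ((c : ℂ) • (1 : Matrix ι ι ℂ) - Q).PosSemidef := by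
  open scoped MatrixOrder Matrix.Norms.L2Operator in
  refine ⟨‖Q‖, ?_⟩
  have := IsSelfAdjoint.le_algebraMap_norm_self (a := Q) hQ
  rw [Matrix.le_iff, Algebra.algebraMap_eq_smul_one] at this
  simpa using this

lemma isHermitian_of_sub_posDef {G H E : Matrix ι ι ℂ} (hG : G.PosSemidef)
    (hE : IsStarProjection E) (h : (H - E * G * E).PosDef) : H.IsHermitian := by
  have h1 : (E * G * E).IsHermitian := by
    have := hG.1
    have hE' : Eᴴ = E := hE.isSelfAdjoint
    simp [IsHermitian, conjTranspose_mul, hE', this.eq, Matrix.mul_assoc]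
  simpa using h.1.add h1

/-- If `E ψ = ψ` for a projection `E` with `E G E < H`, then the transition from `Prob[G, ψ]` to
`Prob[H, ψ]` is expressible by matrices. -/
lemma isEBMLine_of_posDef {G H E : Matrix ι ι ℂ} (hG : G.PosSemidef)
    (hE : IsStarProjection E) (h : (H - E * G * E).PosDef) {ψ : EuclideanSpace ℂ ι}
    (hψ : toEuclideanLin E ψ = ψ) {p q : ℝ≥0 → ℝ≥0} (hp : ∀ z, (p z : ℝ) = prob G ψ z)
    (hq : ∀ z, (q z : ℝ) = prob H ψ z) : IsEBMLine p q := by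
  have hH := isHermitian_of_sub_posDef hG hE h
  have hEE : E * E = E := hE.isIdempotentElem
  have hE' : Eᴴ = E := hE.isSelfAdjoint
  set F : Matrix ι ι ℂ := 1 - E with hF
  have hF' : Fᴴ = F := by simp [hF, hE']
  have hFF : F * F = F := by simp [hF, sub_mul, mul_sub, hEE]
  set D : Matrix ι ι ℂ := H - E * G * E with hD
  have hQ : (F * G * F + (E * G * F)ᴴ * D⁻¹ * (E * G * F)).IsHermitian := by
    have h1 : (F * G * F).PosSemidef := by
      simpa [hF'] using hG.mul_mul_conjTranspose_same F
    exact (h1.add (h.inv.posSemidef.conjTranspose_mul_mul_same _)).1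
  -- `c` is large enough for the Schur complement of `D` in the block matrix below to be
  -- nonnegative. Inverting `D` is where strictness of `E G E < H` enters.
  obtain ⟨c, hc⟩ := exists_smul_one_sub_posSemidef hQ
  -- Two isometries into a doubled space that agree on `ψ` because `E ψ = ψ`. Along `W` the matrix
  -- `G` keeps its spectral distribution, along `J` the matrix `H` does, and the unwanted part of
  -- `G` outside the range of `E` is dominated by `c` in the second block.
  set W : Matrix (ι ⊕ ι) ι ℂ := fromRows E F with hW
  set J : Matrix (ι ⊕ ι) ι ℂ := fromRows 1 0 with hJ
  have hWW : Wᴴ * W = 1 := by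
    rw [hW, conjTranspose_fromRows_eq_fromCols_conjTranspose, fromCols_mul_fromRows, hE', hF',
      hEE, hFF, hF, add_sub_cancel]
  have hJJ : Jᴴ * J = 1 := by
    rw [hJ, conjTranspose_fromRows_eq_fromCols_conjTranspose, fromCols_mul_fromRows]
    simp
  have hGhat : (W * G * Wᴴ).PosSemidef := hG.mul_mul_conjTranspose_same W
  set Hhat : Matrix (ι ⊕ ι) (ι ⊕ ι) ℂ := fromBlocks H 0 0 ((c : ℂ) • 1) with hHhat
  have hWJ : toEuclideanLin W ψ = toEuclideanLin J ψ := by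
    have h1 : E.mulVec ψ.ofLp = ψ.ofLp := by
      simpa [toLpLin_apply] using congrArg WithLp.ofLp hψ
    rw [toLpLin_apply, toLpLin_apply, hW, hJ, fromRows_mulVec, fromRows_mulVec, h1, hF,
      sub_mulVec, h1]
    simp
  have hHH : Hhat.IsHermitian := by
    refine IsHermitian.fromBlocks hH (by simp) ?_
    simp [IsHermitian, conjTranspose_smul]
  refine ⟨ι ⊕ ι, inferInstance, inferInstance, W * G * Wᴴ, Hhat, toEuclideanLin J ψ, hGhat, ?_,
    fun z => ?_, fun z => ?_⟩
  · have h1 : Hhat - W * G * Wᴴ =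
        fromBlocks D (-(E * G * F)) (-(E * G * F))ᴴ ((c : ℂ) • 1 - F * G * F) := by
      rw [hW, conjTranspose_fromRows_eq_fromCols_conjTranspose, fromRows_mul,
        fromRows_mul_fromCols, hE', hF', hHhat, sub_eq_add_neg, fromBlocks_neg,
        fromBlocks_add, conjTranspose_neg,
        conjTranspose_mul, conjTranspose_mul, hE', hF', hG.1.eq]
      simp [hD, Matrix.mul_assoc, sub_eq_add_neg]
    rw [h1]
    have : Invertible D := h.isUnit.invertible
    rw [PosDef.fromBlocks₁₁ _ _ h]
    convert! hc using 1
    rw [conjTranspose_neg, Matrix.neg_mul, Matrix.neg_mul, Matrix.mul_neg, neg_neg, sub_sub]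
  · rw [hp, prob_eq_norm_sq, prob_eq_norm_sq, ← hWJ, ← eigProj_intertwine hG.1 hGhat.1 W,
      norm_toEuclideanLin_of_isometry hWW]
    rw [Matrix.mul_assoc, Matrix.mul_assoc, hWW, Matrix.mul_one]
  · rw [hq, prob_eq_norm_sq, prob_eq_norm_sq, ← eigProj_intertwine hH hHH J,
      norm_toEuclideanLin_of_isometry hJJ]
    rw [hJ, hHhat, fromRows_mul, fromBlocks_mul_fromRows]
    simp

/-! ### Frames of a state for a pair of matrices -/

/-- The frame with weight `‖Π_X^{[x]} Π_Y^{[y]} ψ‖²` at `(x, y)`. -/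
noncomputable def frame (X Y : Matrix ι ι ℂ) (ψ : EuclideanSpace ℂ ι) : Frame :=
  Finsupp.ofSupportFinite (fun z => ‖eigProj X z.1 (eigProj Y z.2 ψ)‖₊ ^ 2) <| by
    refine ((finite_eigProj_ne_zero X).prod (finite_eigProj_ne_zero Y)).subset ?_
    rintro ⟨x, y⟩ h
    refine ⟨fun h' => h ?_, fun h' => h ?_⟩ <;> simp only at h' ⊢ <;> rw [h'] <;> simp

lemma frame_apply (X Y : Matrix ι ι ℂ) (ψ : EuclideanSpace ℂ ι) (x y : ℝ≥0) :
    (frame X Y ψ (x, y) : ℝ) = ‖eigProj X x (eigProj Y y ψ)‖ ^ 2 := rfl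

lemma frame_apply_prob (X Y : Matrix ι ι ℂ) (ψ : EuclideanSpace ℂ ι) (x y : ℝ≥0) :
    (frame X Y ψ (x, y) : ℝ) = prob X (eigProj Y y ψ) x := by
  rw [frame_apply, prob_eq_norm_sq]

lemma frame_swap {X Y : Matrix ι ι ℂ} (hX : X.IsHermitian) (hY : Y.IsHermitian)
    (h : X * Y = Y * X) (ψ : EuclideanSpace ℂ ι) (x y : ℝ≥0) :
    frame X Y ψ (x, y) = frame Y X ψ (y, x) := by
  ext
  rw [frame_apply, frame_apply, eigProj_comm hX hY h]

/-- A unitary commuting with `Y`, preceded by a check commuting with `Y`, changes the frame by an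
EBM line transition in each fibre over an eigenvalue of `Y` (from after to before). -/
lemma isEBMLine_frame {X X' Y E U : Matrix ι ι ℂ} (hX' : X'.PosSemidef) (hY : Y.IsHermitian)
    (hE : IsStarProjection E) (hU : Uᴴ * U = 1) (hUU : U * Uᴴ = 1) (hEY : E * Y = Y * E)
    (hUY : U * Y = Y * U) (h : (X - E * (Uᴴ * X' * U) * E).PosDef) {ψ : EuclideanSpace ℂ ι}
    (hψ : toEuclideanLin E ψ = ψ) (y : ℝ≥0) :
    IsEBMLine (fun x => frame X' Y (toEuclideanLin U ψ) (x, y)) (fun x => frame X Y ψ (x, y)) := by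
  have hG : (Uᴴ * X' * U).PosSemidef := hX'.conjTranspose_mul_mul_same U
  -- The fibre over `y` is the spectral distribution of the component of `ψ` in the `y`-eigenspace
  -- of `Y`. `E` fixes this component because it commutes with `Y`.
  refine isEBMLine_of_posDef hG hE h (ψ := eigProj Y y ψ) ?_ (fun z => ?_) (fun z => ?_)
  · rw [eigProj_intertwine hY hY E hEY, hψ]
  · rw [frame_apply, prob_eq_norm_sq, ← eigProj_intertwine hY hY U hUY,
      ← eigProj_intertwine hG.1 hX'.1 U (by simp only [← Matrix.mul_assoc, hUU, Matrix.one_mul]),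
      norm_toEuclideanLin_of_isometry hU]
  · rw [frame_apply_prob]

end Spectral

/-! ### A separation argument for one round -/

section Duality

lemma nonneg_of_forall_lt_add_mul {a b c : ℝ} (h : ∀ s : ℝ, 0 < s → c < a + s * b) : 0 ≤ b := by
  by_contra! hb
  have h1 := h ((|a - c| + 1) / -b) (by have := abs_nonneg (a - c); apply div_pos <;> linarith)
  have h2 : (|a - c| + 1) / -b * b = -(|a - c| + 1) := by
    rw [div_neg, neg_mul, div_mul_cancel₀ _ hb.ne]
  have h3 := le_abs_self (a - c)
  linarith

variable {ι : Type} [Fintype ι]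

/-- The matrices with positive definite Hermitian part. -/
def rePosDef (ι : Type) [Fintype ι] : Set (Matrix ι ι ℂ) :=
  {X | ∀ v : ι → ℂ, v ≠ 0 → 0 < (star v ⬝ᵥ X *ᵥ v).re}

/-- By homogeneity it suffices to test unit vectors, and positivity on the compact sphere is an open
condition. Positive definite matrices are Hermitian, hence not open among all complex matrices, so
the separation argument uses this larger set. -/
lemma isOpen_rePosDef : IsOpen (rePosDef ι) := by
  have h : rePosDef ι =
      {X | ∀ v ∈ Metric.sphere (0 : ι → ℂ) 1, 0 < (star v ⬝ᵥ X *ᵥ v).re} := by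
    ext X
    refine ⟨fun h v hv => h v (by rintro rfl; simp at hv), fun h v hv => ?_⟩
    have hn : (0 : ℝ) < ‖v‖ := norm_pos_iff.2 hv
    have h1 := h ((‖v‖⁻¹ : ℝ) • v) (by simp [norm_smul, hn.ne'])
    have h2 : star ((‖v‖⁻¹ : ℝ) • v) ⬝ᵥ X *ᵥ ((‖v‖⁻¹ : ℝ) • v) =
        ((‖v‖⁻¹ * ‖v‖⁻¹ : ℝ) : ℝ) • (star v ⬝ᵥ X *ᵥ v) := by
      rw [star_smul, mulVec_smul, dotProduct_smul, smul_dotProduct, smul_smul]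
      simp
    rw [h2, Complex.smul_re, smul_eq_mul] at h1
    exact (mul_pos_iff_of_pos_left (by positivity)).1 h1
  rw [h, isOpen_iff_mem_nhds]
  intro X hX
  refine (isCompact_sphere (0 : ι → ℂ) 1).eventually_forall_of_forall_eventually fun v hv => ?_
  have hc : Continuous fun p : Matrix ι ι ℂ × (ι → ℂ) => (star p.2 ⬝ᵥ p.1 *ᵥ p.2).re := by
    fun_prop
  exact (isOpen_lt continuous_const hc).mem_nhds (hX v hv)

lemma convex_rePosDef : Convex ℝ (rePosDef ι) := by
  intro X hX Y hY a b ha hb hab v hv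
  have h1 := hX v hv
  have h2 := hY v hv
  rw [add_mulVec, dotProduct_add, smul_mulVec, smul_mulVec, dotProduct_smul, dotProduct_smul,
    Complex.add_re, Complex.smul_re, Complex.smul_re, smul_eq_mul, smul_eq_mul]
  rcases ha.eq_or_lt with rfl | ha'
  · have : b = 1 := by linarith
    subst this; simpa using h2
  · have := mul_pos ha' h1
    have := mul_nonneg hb h2.le
    linarith

lemma posDef_of_mem_rePosDef {X : Matrix ι ι ℂ} (hX : X ∈ rePosDef ι) :
    ((2⁻¹ : ℝ) • (X + Xᴴ)).PosDef := by
  have hH : ((2⁻¹ : ℝ) • (X + Xᴴ)).IsHermitian := by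
    simp [IsHermitian, conjTranspose_smul, add_comm]
  refine PosDef.of_dotProduct_mulVec_pos hH fun v hv => ?_
  have him := hH.im_star_dotProduct_mulVec_self v
  rw [Complex.pos_iff]
  refine ⟨?_, him.symm⟩
  have h1 : star v ⬝ᵥ Xᴴ *ᵥ v = star (star v ⬝ᵥ X *ᵥ v) := by
    rw [mulVec_conjTranspose, star_dotProduct_star, dotProduct_mulVec]
  have := hX v hv
  rw [smul_mulVec, add_mulVec, dotProduct_smul, dotProduct_add, h1, Complex.smul_re,
    Complex.add_re]
  simp
  linarith

lemma exists_trace_mul_eq [DecidableEq ι] (f : Matrix ι ι ℂ →ₗ[ℂ] ℂ) :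
    ∃ N : Matrix ι ι ℂ, ∀ X, f X = (N * X).trace := by
  refine ⟨of fun i j => f (single j i 1), fun X => ?_⟩
  conv_lhs => rw [matrix_eq_sum_single X]
  simp only [map_sum, trace, diag, mul_apply, of_apply]
  rw [Finset.sum_comm]
  refine Finset.sum_congr rfl fun i _ => Finset.sum_congr rfl fun j _ => ?_
  rw [mul_comm, ← smul_eq_mul, ← map_smul, smul_single, smul_eq_mul, mul_one]

lemma trace_mul_vecMulVec (N : Matrix ι ι ℂ) (v : ι → ℂ) :
    (N * vecMulVec v (star v)).trace = star v ⬝ᵥ N *ᵥ v := by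
  rw [mul_vecMulVec, trace_vecMulVec, dotProduct_comm]

/-- The cone of positive semidefinite matrices is self-dual. -/
lemma posSemidef_of_forall_trace {N : Matrix ι ι ℂ}
    (h : ∀ X : Matrix ι ι ℂ, (∀ v, 0 ≤ (star v ⬝ᵥ X *ᵥ v).re) → 0 ≤ (N * X).trace.re) :
    N.PosSemidef := by
  classical
  have h1 : ∀ (c : ℂ) (v w : ι → ℂ), (star w ⬝ᵥ (c • vecMulVec v (star v)) *ᵥ w).re =
      c.re * Complex.normSq (star w ⬝ᵥ v) := by
    intro c v w
    rw [smul_mulVec, vecMulVec_mulVec, dotProduct_smul]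
    rw [op_smul_eq_smul, dotProduct_smul, star_dotProduct v w, smul_eq_mul, smul_eq_mul,
      mul_comm (star _), Complex.star_def, Complex.mul_conj, mul_comm, Complex.mul_re]
    simp [mul_comm]
  -- The test matrices need not be Hermitian, so `c = ±i` is allowed and forces the quadratic form
  -- of `N` to be real.
  have h2 : ∀ (c : ℂ), 0 ≤ c.re → ∀ v, 0 ≤ (c * (star v ⬝ᵥ N *ᵥ v)).re := by
    intro c hc v
    have := h (c • vecMulVec v (star v)) fun w => by
      rw [h1]; exact mul_nonneg hc (Complex.normSq_nonneg _)
    rwa [Matrix.mul_smul, trace_smul, trace_mul_vecMulVec, smul_eq_mul] at this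
  have h3 : ∀ v, 0 ≤ star v ⬝ᵥ N *ᵥ v := by
    intro v
    have a := h2 1 (by simp) v
    have b := h2 Complex.I (by simp) v
    have c := h2 (-Complex.I) (by simp) v
    simp at a b c
    rw [Complex.nonneg_iff]
    exact ⟨a, le_antisymm c b⟩
  refine PosSemidef.of_dotProduct_mulVec_nonneg ?_ h3
  rw [← isSymmetric_toEuclideanLin_iff, LinearMap.isSymmetric_iff_inner_map_self_real]
  intro v
  have h4 : inner ℂ (toEuclideanLin N v) v = star (star v.ofLp ⬝ᵥ N *ᵥ v.ofLp) := by
    rw [EuclideanSpace.inner_eq_star_dotProduct, ← star_dotProduct_star, star_star, dotProduct_comm]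
    rfl
  have h5 : star (star v.ofLp ⬝ᵥ N *ᵥ v.ofLp) = star v.ofLp ⬝ᵥ N *ᵥ v.ofLp :=
    (IsSelfAdjoint.of_nonneg (h3 v.ofLp)).star_eq
  rw [h4, h5]
  exact h5

variable {K M : Type} [Fintype K] [DecidableEq K] [Fintype M] [DecidableEq M]

/-- The partial trace over the second factor. -/
def ptrace {K M : Type} [Fintype M] (X : Matrix (K × M) (K × M) ℂ) : Matrix K K ℂ :=
  of fun a b => ∑ m, X (a, m) (b, m)

lemma trace_kronecker_one_mul (Z : Matrix K K ℂ) (X : Matrix (K × M) (K × M) ℂ) :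
    ((Z ⊗ₖ (1 : Matrix M M ℂ)) * X).trace = (Z * ptrace X).trace := by
  simp only [trace, diag, mul_apply, ptrace, of_apply, Fintype.sum_prod_type, kroneckerMap_apply,
    one_apply, Finset.mul_sum]
  refine Finset.sum_congr rfl fun a _ => ?_
  rw [Finset.sum_comm]
  refine Finset.sum_congr rfl fun b _ => Finset.sum_congr rfl fun m _ => ?_
  simp

/-- Strong duality for one round, uniformly over a convex set `D` of continuation operators: a
single `ρ` must work against every `Z ∈ D`. It is the multiplier of a hyperplane separating the dual
pairs (slack, value) from the pairs with positive slack and value below `r`. -/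
lemma exists_posSemidef_of_forall_le {D : Set (Matrix K K ℂ)} (hD : Convex ℝ D)
    (hH : ∀ Z ∈ D, Z.IsHermitian) (hne : D.Nonempty) (V : Matrix (K × M) (K × M) ℂ)
    {σ : Matrix K K ℂ} (hσ : σ.IsHermitian) {r : ℝ}
    (h : ∀ Z ∈ D, ∀ W : Matrix K K ℂ,
      (W ⊗ₖ (1 : Matrix M M ℂ) - Vᴴ * (Z ⊗ₖ (1 : Matrix M M ℂ)) * V).PosDef →
        r ≤ (W * σ).trace.re) :
    ∃ ρ : Matrix (K × M) (K × M) ℂ, ρ.PosSemidef ∧ ptrace ρ = σ ∧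
      ∀ Z ∈ D, r ≤ (Z * ptrace (V * ρ * Vᴴ)).trace.re := by
  set L : Matrix K K ℂ →ₗ[ℂ] Matrix (K × M) (K × M) ℂ :=
    { toFun := fun W => W ⊗ₖ (1 : Matrix M M ℂ)
      map_add' := fun X Y => add_kronecker X Y _
      map_smul' := fun c X => smul_kronecker c X _ } with hL
  set s : Set (Matrix (K × M) (K × M) ℂ × ℂ) := rePosDef (K × M) ×ˢ {t | t.re < r} with hs
  set t : Set (Matrix (K × M) (K × M) ℂ × ℂ) :=
    {p | ∃ W, ∃ Z ∈ D, p = (L W - Vᴴ * L Z * V, (W * σ).trace)} with ht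
  have hs_open : IsOpen s :=
    isOpen_rePosDef.prod (isOpen_lt Complex.continuous_re continuous_const)
  have hs_conv : Convex ℝ s := convex_rePosDef.prod (convex_halfSpace_re_lt r)
  have ht_conv : Convex ℝ t := by
    rintro _ ⟨W, Z, hZ, rfl⟩ _ ⟨W', Z', hZ', rfl⟩ a b ha hb hab
    refine ⟨a • W + b • W', a • Z + b • Z', hD hZ hZ' ha hb hab, ?_⟩
    have hLr : ∀ (c : ℝ) X, L (c • X) = c • L X := fun c X =>
      (L.restrictScalars ℝ).map_smul c X
    ext1
    · simp only [Prod.fst_add, Prod.smul_fst, map_add, hLr, smul_sub, mul_add, add_mul,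
        Matrix.mul_smul, Matrix.smul_mul]
      abel
    · simp [add_mul, trace_add, trace_smul]
  -- At a common point `W` may be replaced by its Hermitian part: the slack becomes positive
  -- definite, and the real part of the trace against the Hermitian `σ` is unchanged.
  have hdisj : Disjoint s t := by
    rw [Set.disjoint_left]
    rintro _ ⟨hX, hX'⟩ ⟨W, Z, hZ, rfl⟩
    have h1 := posDef_of_mem_rePosDef hX
    have h2 := h Z hZ ((2⁻¹ : ℝ) • (W + Wᴴ)) (by
      convert h1 using 1
      have hZ' : (L Z)ᴴ = L Z := by
        simp [hL, conjTranspose_kronecker, (hH Z hZ).eq]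
      simp only [conjTranspose_sub, conjTranspose_mul, conjTranspose_conjTranspose, hZ']
      have hW' : (L W)ᴴ = L Wᴴ := by
        simp [hL, conjTranspose_kronecker]
      have hLr : ∀ (c : ℝ) X, L (c • X) = c • L X := fun c X =>
        (L.restrictScalars ℝ).map_smul c X
      change L ((2⁻¹ : ℝ) • (W + Wᴴ)) - Vᴴ * L Z * V = _
      rw [hW', hLr, map_add, ← Matrix.mul_assoc]
      module)
    have h3 : (((2⁻¹ : ℝ) • (W + Wᴴ)) * σ).trace.re = (W * σ).trace.re := by
      have h4 : (Wᴴ * σ).trace = star (W * σ).trace := by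
        rw [← trace_conjTranspose, conjTranspose_mul, hσ.eq, trace_mul_comm]
      rw [Matrix.smul_mul, add_mul, trace_smul, trace_add, h4, Complex.smul_re, Complex.add_re]
      simp
      ring
    simp only [Set.mem_ofPred_eq] at hX'
    linarith
  obtain ⟨f, u, hfs, hft⟩ := RCLike.geometric_hahn_banach_open (𝕜 := ℂ) hs_conv hs_open ht_conv hdisj
  obtain ⟨N', hN'⟩ := exists_trace_mul_eq (f.toLinearMap ∘ₗ LinearMap.inl ℂ _ _)
  set l : ℂ := f (0, 1) with hl
  set N : Matrix (K × M) (K × M) ℂ := -N' with hN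
  have hf : ∀ X c, f (X, c) = l * c - (N * X).trace := by
    intro X c
    have h1 : (X, c) = (X, 0) + c • ((0, 1) : Matrix (K × M) (K × M) ℂ × ℂ) := by simp
    have h2 := hN' X
    simp only [LinearMap.coe_comp, Function.comp_apply, LinearMap.inl_apply] at h2
    rw [h1, map_add, map_smul, ← hl]
    change f (X, 0) = _ at h2
    rw [h2, hN]
    simp; ring
  have hs' : ∀ X ∈ rePosDef (K × M), ∀ c : ℂ, c.re < r → (l * c).re - (N * X).trace.re < u := by
    intro X hX c hc
    have := hfs (X, c) ⟨hX, hc⟩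
    rw [hf] at this
    simpa using this
  have ht' : ∀ W, ∀ Z ∈ D,
      u ≤ (l * (W * σ).trace).re - (N * (L W - Vᴴ * L Z * V)).trace.re := by
    intro W Z hZ
    have := hft _ ⟨W, Z, hZ, rfl⟩
    rw [hf] at this
    simpa using this
  have hone : (1 : Matrix (K × M) (K × M) ℂ) ∈ rePosDef (K × M) := fun v hv =>
    (Complex.pos_iff.1 (PosDef.one.dotProduct_mulVec_pos hv)).1
  -- The first set is unbounded towards nonnegative `X`, towards `±i` in the value and towards `-∞`
  -- in its real part. Boundedness of the functional there gives `N ≥ 0`, `l` real and `l ≥ 0`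
  -- respectively.
  have hNpos : N.PosSemidef := by
    refine posSemidef_of_forall_trace fun X hX => ?_
    refine nonneg_of_forall_lt_add_mul (a := (N * 1).trace.re) (c := (l * (r - 1 : ℝ)).re - u) ?_
    intro s hs
    have := hs' (1 + (s : ℂ) • X) ?_ (r - 1 : ℝ) (by simp)
    · rw [mul_add, Matrix.mul_smul, trace_add, trace_smul, Complex.add_re, smul_eq_mul,
        Complex.re_ofReal_mul] at this
      linarith
    · intro v hv
      have h1 := hone v hv
      rw [add_mulVec, dotProduct_add, smul_mulVec, dotProduct_smul, Complex.add_re, smul_eq_mul,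
        Complex.re_ofReal_mul]
      have := mul_nonneg hs.le (hX v)
      linarith
  have hl_im : l.im = 0 := by
    have a := nonneg_of_forall_lt_add_mul (a := (N * 1).trace.re - (l * (r - 1 : ℝ)).re)
      (b := l.im) (c := -u) fun s hs => by
        have := hs' 1 hone ((r - 1 : ℝ) + s * Complex.I) (by simp)
        simp [Complex.mul_re] at this ⊢
        linarith
    have b := nonneg_of_forall_lt_add_mul (a := (N * 1).trace.re - (l * (r - 1 : ℝ)).re)
      (b := -l.im) (c := -u) fun s hs => by
        have := hs' 1 hone ((r - 1 : ℝ) - s * Complex.I) (by simp)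
        simp [Complex.mul_re] at this ⊢
        linarith
    linarith
  have hl_re : 0 ≤ l.re := by
    refine nonneg_of_forall_lt_add_mul (a := (N * 1).trace.re - (l * r).re) (c := -u) fun s hs => ?_
    have := hs' 1 hone ((r - s : ℝ)) (by simp [hs])
    simp at this ⊢
    linarith
  -- Limit of the separation bound at the points `(ε 1, r - ε)` as `ε → 0`.
  have hlr : l.re * r ≤ u := by
    refine le_of_forall_pos_lt_add fun e he => ?_
    set k : ℝ := |(N * 1).trace.re + l.re| + 1 with hk
    have hk0 : 0 < k := by positivity
    have hk1 : (N * 1).trace.re + l.re < k := by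
      have := le_abs_self ((N * 1).trace.re + l.re); linarith
    have hd : 0 < e / k := div_pos he hk0
    have := hs' (((e / k : ℝ) : ℂ) • 1) (fun v hv => by
      rw [smul_mulVec, dotProduct_smul, smul_eq_mul, Complex.re_ofReal_mul]
      exact mul_pos hd (hone v hv)) ((r - e / k : ℝ)) (by simpa using hd)
    rw [Matrix.mul_smul, trace_smul, smul_eq_mul, Complex.re_ofReal_mul, Complex.re_mul_ofReal]
      at this
    have h2 := mul_lt_mul_of_pos_left hk1 hd
    rw [div_mul_cancel₀ _ hk0.ne'] at h2
    linarith
  have hl' : l = (l.re : ℂ) := by apply Complex.ext <;> simp [hl_im]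
  obtain ⟨Z₀, hZ₀⟩ := hne
  -- `W` ranges over a whole vector space, and a linear functional bounded below on it vanishes. The
  -- test direction is `-s Qᴴ`.
  have hptr : ptrace N = l • σ := by
    set Q := l • σ - ptrace N with hQ
    have h1 : ∀ W : Matrix K K ℂ, u ≤ (W * Q).trace.re + (N * (Vᴴ * L Z₀ * V)).trace.re := by
      intro W
      have h2 := ht' W Z₀ hZ₀
      have h3 : (N * L W).trace = (W * ptrace N).trace := by
        rw [trace_mul_comm, ← trace_kronecker_one_mul]; rfl
      rw [mul_sub, trace_sub, h3] at h2
      rw [hQ, mul_sub, Matrix.mul_smul, trace_sub, trace_smul, smul_eq_mul, Complex.sub_re]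
      rw [Complex.sub_re] at h2
      linarith
    have h2 : 0 ≤ -(Qᴴ * Q).trace.re := by
      refine nonneg_of_forall_lt_add_mul (a := (N * (Vᴴ * L Z₀ * V)).trace.re) (c := u - 1)
        fun s hs => ?_
      have h3 := h1 (((-s : ℝ) : ℂ) • Qᴴ)
      rw [Matrix.smul_mul, trace_smul, smul_eq_mul, Complex.re_ofReal_mul] at h3
      linarith
    have h3 := posSemidef_conjTranspose_mul_self Q
    have h4 : Q = 0 := by
      rw [← trace_conjTranspose_mul_self_eq_zero_iff]
      have h5 := Complex.nonneg_iff.1 h3.trace_nonneg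
      exact Complex.ext (le_antisymm (by simpa using h2) h5.1) h5.2.symm
    exact (sub_eq_zero.1 h4).symm
  have hval : ∀ Z ∈ D, l.re * r ≤ (Z * ptrace (V * N * Vᴴ)).trace.re := by
    intro Z hZ
    have h1 := ht' 0 Z hZ
    have h2 : ((Z ⊗ₖ (1 : Matrix M M ℂ)) * (V * N * Vᴴ)).trace = (N * (Vᴴ * L Z * V)).trace := by
      change (L Z * (V * N * Vᴴ)).trace = _
      rw [trace_mul_comm, Matrix.mul_assoc, Matrix.mul_assoc V, trace_mul_comm]
      simp only [Matrix.mul_assoc]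
    rw [← trace_kronecker_one_mul, h2]
    simp only [map_zero, Matrix.zero_mul, trace_zero, mul_zero, zero_sub, Matrix.mul_neg,
      trace_neg, Complex.neg_re, Complex.zero_re] at h1
    linarith
  rcases hl_re.eq_or_lt with h0 | hpos
  -- If `l = 0` then `N` is positive with zero partial trace, hence zero, so the functional vanishes
  -- and cannot separate strictly.
  · exfalso
    have hl0 : l = 0 := by rw [hl', ← h0]; simp
    have hN0 : N = 0 := by
      rw [← hNpos.trace_eq_zero_iff]
      have := trace_kronecker_one_mul (1 : Matrix K K ℂ) N
      rw [hptr, hl0] at this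
      simpa using this
    have h1 := hs' 1 hone (r - 1 : ℝ) (by simp)
    have h2 := ht' 0 Z₀ hZ₀
    simp [hN0, hl0] at h1 h2
    linarith
  · have hl0 : l ≠ 0 := by intro h; rw [h] at hpos; simp at hpos
    refine ⟨l⁻¹ • N, ?_, ?_, fun Z hZ => ?_⟩
    · refine hNpos.smul ?_
      rw [hl', ← Complex.ofReal_inv]
      exact_mod_cast (inv_pos.2 hpos).le
    · have : ptrace (l⁻¹ • N) = l⁻¹ • ptrace N := by
        ext a b; simp [ptrace, Finset.mul_sum]
      rw [this, hptr, smul_smul, inv_mul_cancel₀ hl0, one_smul]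
    · have h1 := hval Z hZ
      rw [← trace_kronecker_one_mul] at h1 ⊢
      rw [Matrix.mul_smul, Matrix.smul_mul, Matrix.mul_smul, trace_smul, hl', ← Complex.ofReal_inv,
        smul_eq_mul, Complex.re_ofReal_mul, inv_mul_eq_div, le_div_iff₀ hpos, mul_comm]
      exact h1

end Duality

/-! ### Pure strategies -/

section Purification

/-- Two factorisations `X X* = Y Y*` differ by a unitary. -/
lemma exists_unitary_mul_eq {K R : Type} [Fintype K] [DecidableEq K] [Fintype R] [DecidableEq R]
    {X Y : Matrix K R ℂ} (h : X * Xᴴ = Y * Yᴴ) :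
    ∃ U ∈ unitaryGroup R ℂ, Y = X * U := by
  set a := toEuclideanLin Xᴴ with ha
  set b := toEuclideanLin Yᴴ with hb
  have hab : ∀ v, ‖a v‖ = ‖b v‖ := by
    intro v
    have h1 : inner ℂ (a v) (a v) = inner ℂ (b v) (b v) := by
      rw [← LinearMap.adjoint_inner_right, ← LinearMap.adjoint_inner_right b, ha, hb,
        ← toEuclideanLin_conjTranspose_eq_adjoint, ← toEuclideanLin_conjTranspose_eq_adjoint,
        ← toEuclideanLin_mul, ← toEuclideanLin_mul, conjTranspose_conjTranspose,
        conjTranspose_conjTranspose, h]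
    rw [inner_self_eq_norm_sq_to_K, inner_self_eq_norm_sq_to_K] at h1
    exact (pow_left_inj₀ (norm_nonneg _) (norm_nonneg _) two_ne_zero).1 (by exact_mod_cast h1)
  -- By `hab` the rule `Xᴴ v ↦ Yᴴ v` is a well-defined isometry on the range of `Xᴴ`; `g` chooses
  -- preimages. In finite dimension it extends to a unitary.
  obtain ⟨g, hg⟩ := a.rangeRestrict.exists_rightInverse_of_surjective a.range_rangeRestrict
  have hg' : ∀ s, a (g s) = s := fun s => congrArg Subtype.val (LinearMap.congr_fun hg s)
  let L : LinearMap.range a →ₗᵢ[ℂ] EuclideanSpace ℂ R :=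
    { toLinearMap := b ∘ₗ g
      norm_map' := fun s => by
        change ‖b (g s)‖ = ‖s‖
        rw [← hab, hg']; rfl }
  have hT : ∀ v, L.extend (a v) = b v := by
    intro v
    have h1 := L.extend_apply ⟨a v, LinearMap.mem_range_self a v⟩
    have h2 : L ⟨a v, LinearMap.mem_range_self a v⟩ =
      b (g ⟨a v, LinearMap.mem_range_self a v⟩) := rfl
    rw [h1, h2, ← sub_eq_zero, ← map_sub, ← norm_eq_zero, ← hab, map_sub, hg', sub_self, norm_zero]
  set T := toEuclideanLin.symm L.extend.toLinearMap with hTdef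
  have hTv : ∀ v, toEuclideanLin T v = L.extend v := by
    intro v; rw [hTdef, LinearEquiv.apply_symm_apply]; rfl
  have hTT : Tᴴ * T = 1 := by
    apply toEuclideanLin.injective
    ext1 v
    refine ext_inner_left ℂ fun w => ?_
    rw [toEuclideanLin_mul, toEuclideanLin_conjTranspose_eq_adjoint, LinearMap.adjoint_inner_right,
      hTv, hTv, L.extend.inner_map_map]
    simp
  have hTX : T * Xᴴ = Yᴴ := by
    apply toEuclideanLin.injective
    ext1 v
    rw [toEuclideanLin_mul, hTv]
    exact hT v
  refine ⟨Tᴴ, ?_, ?_⟩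
  · rw [mem_unitaryGroup_iff, star_eq_conjTranspose, conjTranspose_conjTranspose]
    exact hTT
  · rw [← conjTranspose_conjTranspose Y, ← hTX, conjTranspose_mul, conjTranspose_conjTranspose]

/-! ### Reduced states, steering, and strong duality over several rounds. -/

variable {K M W : Type} [Fintype K] [DecidableEq K] [Fintype M] [DecidableEq M] [Fintype W]
  [DecidableEq W]

/-- The reduced state of a vector on the first two tensor factors. -/
def reduced {K M W : Type} [Fintype W] (Φ : K × M × W → ℂ) : Matrix (K × M) (K × M) ℂ :=
  of fun p q => ∑ w, Φ (p.1, p.2, w) * star (Φ (q.1, q.2, w))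

lemma onAM_mulVec_apply (V : Matrix (K × M) (K × M) ℂ) (Φ : K × M × W → ℂ) (k : K) (m : M) (w : W) :
    (onAM W V *ᵥ Φ) (k, m, w) = ∑ p : K × M, V (k, m) p * Φ (p.1, p.2, w) := by
  simp [mulVec, dotProduct, onAM, Fintype.sum_prod_type, one_apply]

lemma onMB_mulVec_apply (Y : Matrix (M × W) (M × W) ℂ) (Φ : K × M × W → ℂ) (k : K) (r : M × W) :
    (onMB K Y *ᵥ Φ) (k, r) = ∑ s : M × W, Y r s * Φ (k, s) := by
  simp [mulVec, dotProduct, onMB, Fintype.sum_prod_type, one_apply]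

lemma reduced_onAM (V : Matrix (K × M) (K × M) ℂ) (Φ : K × M × W → ℂ) :
    reduced (onAM W V *ᵥ Φ) = V * reduced Φ * Vᴴ := by
  have h : ∀ Ψ : K × M × W → ℂ, reduced Ψ =
      (of fun (p : K × M) w => Ψ (p.1, p.2, w)) * (of fun (p : K × M) w => Ψ (p.1, p.2, w))ᴴ := by
    intro Ψ; ext p q; simp [reduced, mul_apply]
  have h2 : (of fun (p : K × M) w => (onAM W V *ᵥ Φ) (p.1, p.2, w)) =
      V * (of fun (p : K × M) w => Φ (p.1, p.2, w)) := by
    ext ⟨k, m⟩ w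
    simp [onAM_mulVec_apply, mul_apply]
  rw [h, h2, h Φ, conjTranspose_mul]
  simp only [Matrix.mul_assoc]

/-- In this Gram form, two vectors with equal reduced states on `K` fall under
`exists_unitary_mul_eq`. -/
lemma ptrace_reduced (Φ : K × M × W → ℂ) : ptrace (reduced Φ) =
    (of fun k (r : M × W) => Φ (k, r)) * (of fun k (r : M × W) => Φ (k, r))ᴴ := by
  ext a b
  simp [ptrace, reduced, mul_apply, Fintype.sum_prod_type]

open scoped MatrixOrder Matrix.Norms.L2Operator in
lemma exists_eq_conjTranspose_mul_self {ι : Type} [Fintype ι] [DecidableEq ι] {ρ : Matrix ι ι ℂ}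
    (hρ : ρ.PosSemidef) : ∃ C : Matrix ι ι ℂ, ρ = Cᴴ * C :=
  CStarAlgebra.nonneg_iff_eq_star_mul_self.1 hρ.nonneg

/-- A party holding a purification of `ptrace ρ` can steer to a purification of `ρ`. -/
lemma exists_unitary_reduced_eq (Φ : K × M × (K × M) → ℂ) {ρ : Matrix (K × M) (K × M) ℂ}
    (hρ : ρ.PosSemidef) (h : ptrace ρ = ptrace (reduced Φ)) :
    ∃ u ∈ unitaryGroup (M × (K × M)) ℂ, reduced (onMB K u *ᵥ Φ) = ρ := by
  obtain ⟨C, hC⟩ := exists_eq_conjTranspose_mul_self hρ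
  -- The columns of `C`, conjugated, form a purification of `ρ = Cᴴ C`. A workspace indexed by `K ×
  -- M` is therefore always large enough.
  set Ψ : K × M × (K × M) → ℂ := fun x => star (C x.2.2 (x.1, x.2.1)) with hΨ
  have hΨρ : reduced Ψ = ρ := by
    ext p q
    simp [reduced, hΨ, hC, mul_apply]
  rw [← hΨρ, ptrace_reduced, ptrace_reduced] at h
  obtain ⟨U, hU, hUe⟩ := exists_unitary_mul_eq h.symm
  -- An operator on the last two factors multiplies the coefficient matrix on the right by its
  -- transpose.
  refine ⟨Uᵀ, transpose_mem_unitaryGroup_iff.2 hU, ?_⟩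
  have h1 : onMB K Uᵀ *ᵥ Φ = Ψ := by
    ext ⟨k, r⟩
    have h2 := congrFun (congrFun hUe k) r
    simp only [of_apply, mul_apply] at h2
    rw [onMB_mulVec_apply, h2]
    exact Finset.sum_congr rfl fun s _ => by rw [transpose_apply, mul_comm]
  rw [h1, hΨρ]

/-- The evolution of a vector when unitaries `u j` of the last two factors alternate with operators
`V j` on the first two. -/
def pureState {K M W : Type} [Fintype K] [DecidableEq K] [Fintype M] [DecidableEq M] [Fintype W]
    [DecidableEq W] (V : ℕ → Matrix (K × M) (K × M) ℂ) (u : ℕ → Matrix (M × W) (M × W) ℂ)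
    (Φ : K × M × W → ℂ) : ℕ → (K × M × W → ℂ)
  | 0 => Φ
  | j + 1 => onAM W (V j) *ᵥ (onMB K (u j) *ᵥ pureState V u Φ j)

/-- `pureState` is defined by its last round, whereas `dualSet` and the duality induction peel off
the first. -/
lemma pureState_succ (V : ℕ → Matrix (K × M) (K × M) ℂ) (u : ℕ → Matrix (M × W) (M × W) ℂ)
    (Φ : K × M × W → ℂ) (m : ℕ) : pureState V u Φ (m + 1) =
      pureState (fun j => V (j + 1)) (fun j => u (j + 1))
        (onAM W (V 0) *ᵥ (onMB K (u 0) *ᵥ Φ)) m := by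
  induction m with
  | zero => rfl
  | succ m ih => rw [pureState, ih]; rfl

/-- The first entries of the dual feasible sequences for `m` rounds of the operators `V j` with final
value `Z`. -/
def dualSet {K M : Type} [Fintype K] [DecidableEq K] [Fintype M] [DecidableEq M]
    (Z : Matrix K K ℂ) : ℕ → (ℕ → Matrix (K × M) (K × M) ℂ) → Set (Matrix K K ℂ)
  | 0, _ => {Z}
  | m + 1, V => {X | ∃ Y ∈ dualSet Z m (fun j => V (j + 1)),
      (X ⊗ₖ (1 : Matrix M M ℂ) - (V 0)ᴴ * (Y ⊗ₖ (1 : Matrix M M ℂ)) * V 0).PosDef}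

lemma kronecker_one_posSemidef {X : Matrix K K ℂ} (h : X.PosSemidef) :
    (X ⊗ₖ (1 : Matrix M M ℂ)).PosSemidef := h.kronecker PosSemidef.one

lemma posSemidef_of_kronecker_one [Nonempty M] {X : Matrix K K ℂ}
    (h : (X ⊗ₖ (1 : Matrix M M ℂ)).PosSemidef) : X.PosSemidef := by
  have h1 := h.submatrix (fun k => (k, Classical.arbitrary M))
  convert! h1 using 1
  ext a b
  simp

lemma dualSet_posSemidef [Nonempty M] {Z : Matrix K K ℂ} (hZ : Z.PosSemidef) (m : ℕ)
    (V : ℕ → Matrix (K × M) (K × M) ℂ) : ∀ X ∈ dualSet Z m V, X.PosSemidef := by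
  induction m generalizing V with
  | zero => rintro X rfl; exact hZ
  | succ m ih =>
    rintro X ⟨Y, hY, hX⟩
    refine posSemidef_of_kronecker_one (M := M) ?_
    have h1 := ((kronecker_one_posSemidef (M := M) (ih _ Y hY)).conjTranspose_mul_mul_same (V 0))
    simpa using hX.posSemidef.add h1

lemma dualSet_nonempty [Nonempty M] {Z : Matrix K K ℂ} (hZ : Z.PosSemidef) (m : ℕ)
    (V : ℕ → Matrix (K × M) (K × M) ℂ) : (dualSet Z m V).Nonempty := by
  induction m generalizing V with
  | zero => exact ⟨Z, rfl⟩
  | succ m ih =>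
    obtain ⟨Y, hY⟩ := ih fun j => V (j + 1)
    have h1 := ((kronecker_one_posSemidef (M := M)
      (dualSet_posSemidef hZ _ _ Y hY)).conjTranspose_mul_mul_same (V 0))
    obtain ⟨c, hc⟩ := exists_smul_one_sub_posSemidef
      (h1.1.add (isHermitian_one (n := K × M) (α := ℂ)))
    refine ⟨(c : ℂ) • 1, Y, hY, ?_⟩
    have := PosDef.one.add_posSemidef hc
    convert this using 1
    rw [smul_kronecker, one_kronecker_one]
    abel

/-- The constraints are jointly affine in successive operators. Convexity lets the continuations of
a round serve as `D` in `exists_posSemidef_of_forall_le`. -/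
lemma dualSet_convex (Z : Matrix K K ℂ) (m : ℕ) (V : ℕ → Matrix (K × M) (K × M) ℂ) :
    Convex ℝ (dualSet Z m V) := by
  induction m generalizing V with
  | zero => exact convex_singleton Z
  | succ m ih =>
    rw [convex_iff_forall_pos]
    rintro X ⟨Y, hY, hX⟩ X' ⟨Y', hY', hX'⟩ a b ha hb hab
    refine ⟨a • Y + b • Y', ih _ hY hY' ha.le hb.le hab, ?_⟩
    convert (hX.smul ha).add (hX'.smul hb) using 1
    simp only [add_kronecker, smul_kronecker, mul_add, add_mul, Matrix.mul_smul, Matrix.smul_mul,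
      smul_sub]
    abel

/-- Strong duality: if every dual feasible sequence has value at least `r`, then so does some
sequence of unitary responses. -/
lemma exists_strategy_of_forall_dualSet_le [Nonempty M] {Z : Matrix K K ℂ} (hZ : Z.PosSemidef)
    (m : ℕ) (V : ℕ → Matrix (K × M) (K × M) ℂ) (Φ : K × M × (K × M) → ℂ) {r : ℝ}
    (h : ∀ X ∈ dualSet Z m V, r ≤ (X * ptrace (reduced Φ)).trace.re) :
    ∃ u : ℕ → Matrix (M × (K × M)) (M × (K × M)) ℂ, (∀ j, u j ∈ unitaryGroup _ ℂ) ∧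
      r ≤ (Z * ptrace (reduced (pureState V u Φ m))).trace.re := by
  induction m generalizing V Φ with
  | zero => exact ⟨fun _ => 1, fun _ => one_mem _, h Z rfl⟩
  | succ m ih =>
    have hσ : (ptrace (reduced Φ)).IsHermitian := by
      rw [ptrace_reduced]; exact (posSemidef_self_mul_conjTranspose _).1
    -- The first round is dualised against all continuations at once; the `ρ` obtained satisfies the
    -- induction hypothesis for the remaining rounds.
    obtain ⟨ρ, hρ, hρσ, hr⟩ := exists_posSemidef_of_forall_le
      (dualSet_convex Z m fun j => V (j + 1)) (fun Y hY => (dualSet_posSemidef hZ _ _ Y hY).1)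
      (dualSet_nonempty hZ _ _) (V 0) hσ (r := r) (fun Y hY X hX => h X ⟨Y, hY, hX⟩)
    obtain ⟨u₀, hu₀, hred⟩ := exists_unitary_reduced_eq Φ hρ hρσ
    obtain ⟨u, hu, hval⟩ := ih (fun j => V (j + 1)) (onAM _ (V 0) *ᵥ (onMB K u₀ *ᵥ Φ)) (by
      intro X hX
      rw [reduced_onAM, hred]
      exact hr X hX)
    refine ⟨fun j => Nat.casesOn j u₀ u, fun j => ?_, ?_⟩
    · cases j with
      | zero => exact hu₀
      | succ j => exact hu j
    · rw [pureState_succ]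
      exact hval

/-- The dual feasible sequence witnessing membership in `dualSet`. -/
lemma exists_seq_of_mem_dualSet {Z : Matrix K K ℂ} {m : ℕ}
    {V : ℕ → Matrix (K × M) (K × M) ℂ} {X : Matrix K K ℂ} (hX : X ∈ dualSet Z m V) :
    ∃ Y : ℕ → Matrix K K ℂ, Y 0 = X ∧ Y m = Z ∧ ∀ j < m,
      (Y j ⊗ₖ (1 : Matrix M M ℂ) - (V j)ᴴ * (Y (j + 1) ⊗ₖ (1 : Matrix M M ℂ)) * V j).PosDef := by
  induction m generalizing V X with
  | zero => exact ⟨fun _ => X, rfl, hX, by simp⟩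
  | succ m ih =>
    obtain ⟨X', hX', hpos⟩ := hX
    obtain ⟨Y, h0, hm, hY⟩ := ih hX'
    refine ⟨fun j => Nat.casesOn j X Y, rfl, hm, fun j hj => ?_⟩
    cases j with
    | zero => subst h0; exact hpos
    | succ j => exact hY j (by omega)

end Purification

/-! ### Operators on tensor factors -/

section Tensor

variable {A M B : Type} [Fintype A] [DecidableEq A] [Fintype M] [DecidableEq M]
  [Fintype B] [DecidableEq B]

lemma onAM_mul (X Y : Matrix (A × M) (A × M) ℂ) : onAM B (X * Y) = onAM B X * onAM B Y := by
  rw [onAM, onAM, onAM, reindex_apply, reindex_apply, reindex_apply,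
    submatrix_mul_equiv, ← mul_kronecker_mul, Matrix.one_mul]

lemma onAM_conjTranspose (X : Matrix (A × M) (A × M) ℂ) : (onAM B X)ᴴ = onAM B Xᴴ := by
  rw [onAM, onAM, conjTranspose_reindex, conjTranspose_kronecker, conjTranspose_one]

lemma onAM_one : onAM B (1 : Matrix (A × M) (A × M) ℂ) = 1 := by
  rw [onAM, one_kronecker_one, reindex_apply, submatrix_one_equiv]

lemma onAM_sub (X Y : Matrix (A × M) (A × M) ℂ) : onAM B (X - Y) = onAM B X - onAM B Y := by
  ext; simp [onAM, sub_mul]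

lemma onAM_posSemidef {X : Matrix (A × M) (A × M) ℂ} (h : X.PosSemidef) :
    (onAM B X).PosSemidef := by
  rw [onAM, reindex_apply]
  exact (h.kronecker PosSemidef.one).submatrix _

lemma onAM_posDef {X : Matrix (A × M) (A × M) ℂ} (h : X.PosDef) : (onAM B X).PosDef := by
  rw [onAM, reindex_apply]
  exact (h.kronecker PosDef.one).submatrix (Equiv.injective _)

lemma onMB_mul (X Y : Matrix (M × B) (M × B) ℂ) : onMB A (X * Y) = onMB A X * onMB A Y := by
  rw [onMB, onMB, onMB, ← mul_kronecker_mul, Matrix.one_mul]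

lemma onMB_conjTranspose (X : Matrix (M × B) (M × B) ℂ) : (onMB A X)ᴴ = onMB A Xᴴ := by
  rw [onMB, onMB, conjTranspose_kronecker, conjTranspose_one]

lemma onMB_one : onMB A (1 : Matrix (M × B) (M × B) ℂ) = 1 := one_kronecker_one

lemma onMB_sub (X Y : Matrix (M × B) (M × B) ℂ) : onMB A (X - Y) = onMB A X - onMB A Y := by
  ext; simp [onMB, mul_sub]

lemma onMB_sum {ι : Type} (s : Finset ι) (X : ι → Matrix (M × B) (M × B) ℂ) :
    onMB A (∑ j ∈ s, X j) = ∑ j ∈ s, onMB A (X j) := by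
  ext; simp [onMB, Matrix.sum_apply, Finset.mul_sum]

lemma onAM_sum {ι : Type} (s : Finset ι) (X : ι → Matrix (A × M) (A × M) ℂ) :
    onAM B (∑ j ∈ s, X j) = ∑ j ∈ s, onAM B (X j) := by
  ext; simp [onAM, Matrix.sum_apply, Finset.sum_mul]

lemma onMB_posSemidef {X : Matrix (M × B) (M × B) ℂ} (h : X.PosSemidef) :
    (onMB A X).PosSemidef := PosSemidef.one.kronecker h

lemma onMB_posDef {X : Matrix (M × B) (M × B) ℂ} (h : X.PosDef) : (onMB A X).PosDef :=
  PosDef.one.kronecker h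

lemma onAB_one_right (Z : Matrix A A ℂ) :
    onAB M Z (1 : Matrix B B ℂ) = onAM B (Z ⊗ₖ (1 : Matrix M M ℂ)) := by
  rw [onAB, onAM, kronecker_assoc]

lemma onAB_one_left (Z : Matrix B B ℂ) :
    onAB M (1 : Matrix A A ℂ) Z = onMB A ((1 : Matrix M M ℂ) ⊗ₖ Z) := rfl

/-! ### States -/

lemma mul_ketbra_mul {ι κ : Type} [Fintype ι] [Fintype κ] (T : Matrix κ ι ℂ) (v : ι → ℂ) :
    T * ketbra v * Tᴴ = ketbra (T *ᵥ v) := by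
  rw [ketbra, ketbra, mul_vecMulVec, vecMulVec_mul, star_mulVec]

lemma ketbra_posSemidef {ι : Type} [Fintype ι] (v : ι → ℂ) : (ketbra v).PosSemidef :=
  posSemidef_vecMulVec_self_star v

lemma trace_ketbra {ι : Type} [Fintype ι] (v : ι → ℂ) : (ketbra v).trace = (sqNorm v : ℂ) := by
  rw [ketbra, trace_vecMulVec, sqNorm, dotProduct]
  push_cast
  exact Finset.sum_congr rfl fun i _ => Complex.mul_conj' (v i)

lemma isDensity_ketbra {ι : Type} [Fintype ι] {v : ι → ℂ} (hv : sqNorm v = 1) :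
    IsDensity (ketbra v) :=
  ⟨ketbra_posSemidef _, by rw [trace_ketbra, hv, Complex.ofReal_one]⟩

lemma exists_sqNorm_eq_one (ι : Type) [Fintype ι] [DecidableEq ι] [Nonempty ι] :
    ∃ v : ι → ℂ, sqNorm v = 1 :=
  ⟨Pi.single (Classical.arbitrary ι) 1, by simp [sqNorm, Pi.single_apply, apply_ite norm, ite_pow]⟩

lemma sum_mul_star_eq_one {ι : Type} [Fintype ι] {v : ι → ℂ} (hv : sqNorm v = 1) :
    ∑ i, v i * star (v i) = 1 := by
  have h := trace_ketbra v
  rw [hv, Complex.ofReal_one] at h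
  exact h

lemma trace_mul_re_nonneg {ι : Type} [Fintype ι] [DecidableEq ι] {X ρ : Matrix ι ι ℂ}
    (hX : X.PosSemidef) (hρ : ρ.PosSemidef) : 0 ≤ (X * ρ).trace.re := by
  obtain ⟨C, rfl⟩ := exists_eq_conjTranspose_mul_self hρ
  rw [← Matrix.mul_assoc, trace_mul_comm, ← Matrix.mul_assoc]
  exact (Complex.nonneg_iff.1 (hX.mul_mul_conjTranspose_same C).trace_nonneg).1

lemma trace_mul_re_le {ι : Type} [Fintype ι] [DecidableEq ι] {X Y ρ : Matrix ι ι ℂ}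
    (h : (Y - X).PosSemidef) (hρ : ρ.PosSemidef) : (X * ρ).trace.re ≤ (Y * ρ).trace.re := by
  have := trace_mul_re_nonneg h hρ
  rw [sub_mul, trace_sub, Complex.sub_re] at this
  linarith

lemma trace_sum_kraus {ι κ : Type} [Fintype ι] [DecidableEq ι] [Fintype κ] {T : κ → Matrix ι ι ℂ}
    (hT : ∑ j, (T j)ᴴ * T j = 1) (ρ : Matrix ι ι ℂ) :
    (∑ j, T j * ρ * (T j)ᴴ).trace = ρ.trace := by
  conv_rhs => rw [← Matrix.one_mul ρ, ← hT, Finset.sum_mul]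
  rw [trace_sum, trace_sum]
  refine Finset.sum_congr rfl fun j _ => ?_
  rw [trace_mul_comm, Matrix.mul_assoc]

lemma trace_contraction_le {ι : Type} [Fintype ι] [DecidableEq ι] {T ρ : Matrix ι ι ℂ}
    (hT : (1 - Tᴴ * T).PosSemidef) (hρ : ρ.PosSemidef) :
    (T * ρ * Tᴴ).trace.re ≤ ρ.trace.re := by
  have := trace_mul_re_le hT hρ
  rwa [Matrix.one_mul, trace_mul_comm, ← Matrix.mul_assoc, trace_mul_comm, ← Matrix.mul_assoc]
    at this

lemma one_sub_star_mul_self_posSemidef {ι : Type} [Fintype ι] [DecidableEq ι] {U E : Matrix ι ι ℂ}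
    (hU : U ∈ unitaryGroup ι ℂ) (hE : IsStarProjection E) :
    (1 - (U * E)ᴴ * (U * E)).PosSemidef := by
  have hE1 : E * E = E := hE.isIdempotentElem
  have hE2 : Eᴴ = E := hE.isSelfAdjoint
  have hU' : Uᴴ * U = 1 := mem_unitaryGroup_iff'.1 hU
  have h1 : (U * E)ᴴ * (U * E) = E := by
    rw [conjTranspose_mul, Matrix.mul_assoc, ← Matrix.mul_assoc Uᴴ, hU', Matrix.one_mul, hE2, hE1]
  have h2 : 1 - E = (1 - E)ᴴ * (1 - E) := by
    simp [hE2, sub_mul, mul_sub, hE1]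
  rw [h1, h2]
  exact posSemidef_conjTranspose_mul_self _

lemma trace_onAB_mul_ketbra (Z : Matrix A A ℂ) (Φ : A × M × B → ℂ) :
    (onAB M Z (1 : Matrix B B ℂ) * ketbra Φ).trace = (Z * ptrace (reduced Φ)).trace := by
  rw [← trace_kronecker_one_mul, onAB_one_right, ketbra, mul_vecMulVec, trace_vecMulVec]
  change ∑ x, (onAM B (Z ⊗ₖ (1 : Matrix M M ℂ)) *ᵥ Φ) x * star (Φ x) = _
  rw [← Equiv.sum_comp (Equiv.prodAssoc A M B), Fintype.sum_prod_type]
  simp only [Equiv.prodAssoc_apply, onAM_mulVec_apply, trace, diag, mul_apply, reduced, of_apply, Finset.mul_sum,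
    Finset.sum_mul, mul_assoc]
  refine Finset.sum_congr rfl fun p _ => ?_
  rw [Finset.sum_comm]

/-- No signalling: a unitary away from `A` cancels in the Gram form of the reduced state. -/
lemma ptrace_reduced_onMB {u : Matrix (M × B) (M × B) ℂ} (hu : u ∈ unitaryGroup (M × B) ℂ)
    (Φ : A × M × B → ℂ) : ptrace (reduced (onMB A u *ᵥ Φ)) = ptrace (reduced Φ) := by
  have h1 : (of fun k (r : M × B) => (onMB A u *ᵥ Φ) (k, r)) =
      (of fun k (r : M × B) => Φ (k, r)) * uᵀ := by
    ext k r
    simp only [of_apply, mul_apply, onMB_mulVec_apply, transpose_apply]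
    exact Finset.sum_congr rfl fun s _ => mul_comm _ _
  have h2 : uᵀ * (uᵀ)ᴴ = 1 := mem_unitaryGroup_iff.1 (transpose_mem_unitaryGroup_iff.2 hu)
  rw [ptrace_reduced, ptrace_reduced, h1, conjTranspose_mul, Matrix.mul_assoc,
    ← Matrix.mul_assoc uᵀ, h2, Matrix.one_mul]

/-! ### Reversing the order of the tensor factors -/

/-- A vector with its tensor factors in reversed order. -/
def rev {A M B : Type} (Φ : A × M × B → ℂ) : B × M × A → ℂ := fun x => Φ (x.2.2, x.2.1, x.1)

lemma onMB_mulVec_rev (Y : Matrix (M × B) (M × B) ℂ) (Φ : B × M × A → ℂ) :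
    onMB A Y *ᵥ rev Φ = rev (onAM A (Y.submatrix Prod.swap Prod.swap) *ᵥ Φ) := by
  ext ⟨a, m, b⟩
  rw [onMB_mulVec_apply, rev, onAM_mulVec_apply]
  exact Fintype.sum_equiv (Equiv.prodComm M B) _ _ fun _ => rfl

lemma onAM_mulVec_rev (u : Matrix (M × A) (M × A) ℂ) (Φ : B × M × A → ℂ) :
    onAM B (u.submatrix Prod.swap Prod.swap) *ᵥ rev Φ = rev (onMB B u *ᵥ Φ) := by
  ext ⟨a, m, b⟩
  rw [onAM_mulVec_apply, rev, onMB_mulVec_apply]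
  exact Fintype.sum_equiv (Equiv.prodComm A M) _ _ fun _ => rfl

lemma trace_onAB_mul_ketbra_rev (Z : Matrix B B ℂ) (Φ : B × M × A → ℂ) :
    (onAB M (1 : Matrix A A ℂ) Z * ketbra (rev Φ)).trace = (Z * ptrace (reduced Φ)).trace := by
  have h : (((1 : Matrix M M ℂ) ⊗ₖ Z).submatrix Prod.swap Prod.swap) =
      Z ⊗ₖ (1 : Matrix M M ℂ) := by
    ext ⟨b, m⟩ ⟨b', m'⟩; simp [mul_comm]
  rw [← trace_onAB_mul_ketbra, onAB_one_right, onAB_one_left, ketbra, ketbra, mul_vecMulVec,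
    mul_vecMulVec, trace_vecMulVec, trace_vecMulVec, onMB_mulVec_rev, h]
  refine Fintype.sum_equiv (⟨fun x => (x.2.2, x.2.1, x.1), fun x => (x.2.2, x.2.1, x.1),
    fun _ => rfl, fun _ => rfl⟩ : A × M × B ≃ B × M × A) _ _ fun _ => rfl

end Tensor

/-- The channel `ρ ↦ u ρ u*`. -/
def unitaryChannel {H : Type} [Fintype H] [DecidableEq H] (u : Matrix H H ℂ)
    (hu : u ∈ unitaryGroup H ℂ) : Channel H where
  rank := 1
  kraus := fun _ => u
  complete := by
    rw [Fin.sum_univ_one]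
    exact mem_unitaryGroup_iff'.1 hu

lemma sum_unitaryChannel {H α : Type} [Fintype H] [DecidableEq H] [AddCommMonoid α]
    {u : Matrix H H ℂ} (hu : u ∈ unitaryGroup H ℂ) (f : Matrix H H ℂ → α) :
    ∑ j, f ((unitaryChannel u hu).kraus j) = f u :=
  Fin.sum_univ_one fun _ => f u

/-! ### Reward operators, boundedness of the rewards, and dual certificates. -/

namespace Protocol

variable {A M B : Type} [Fintype A] [DecidableEq A] [Fintype M] [DecidableEq M]
  [Fintype B] [DecidableEq B] {P : Protocol A M B}

/-- The operator whose expectation is the reward of cheating Bob. -/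
def rewardOpA (P : Protocol A M B) (Λ : ℝ≥0) : Matrix A A ℂ :=
  ((Λ : ℝ) + 1 : ℂ) • P.PiA (some 1) + ((Λ : ℝ) : ℂ) • P.PiA (some 0)

/-- The operator whose expectation is the reward of cheating Alice. -/
def rewardOpB (P : Protocol A M B) (Λ : ℝ≥0) : Matrix B B ℂ :=
  ((Λ : ℝ) + 1 : ℂ) • P.PiB (some 0) + ((Λ : ℝ) : ℂ) • P.PiB (some 1)

lemma combination_posSemidef {ι : Type} [Fintype ι] [DecidableEq ι] {Q : Outcome → Matrix ι ι ℂ}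
    (hQ : IsPOVM Q) (Λ : ℝ≥0) (x y : Fin 2) :
    (((Λ : ℝ) + 1 : ℂ) • Q (some x) + ((Λ : ℝ) : ℂ) • Q (some y)).PosSemidef := by
  refine ((hQ.1 _).smul ?_).add ((hQ.1 _).smul ?_)
  · exact_mod_cast (by positivity : (0 : ℝ) ≤ Λ + 1)
  · exact_mod_cast Λ.2

/-- The difference equals `(Λ + 1) Q_⊥ + Q_y` by completeness of the POVM. -/
lemma sub_combination_posSemidef {ι : Type} [Fintype ι] [DecidableEq ι]
    {Q : Outcome → Matrix ι ι ℂ} (hQ : IsPOVM Q) (Λ : ℝ≥0) {x y : Fin 2} (hxy : x ≠ y) :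
    (((Λ : ℝ) + 1 : ℂ) • (1 : Matrix ι ι ℂ) -
      (((Λ : ℝ) + 1 : ℂ) • Q (some x) + ((Λ : ℝ) : ℂ) • Q (some y))).PosSemidef := by
  have h1 : ∑ a, Q a = Q none + (Q (some x) + Q (some y)) := by
    rw [Fintype.sum_option, Fin.sum_univ_two]
    congr 1
    fin_cases x <;> fin_cases y <;> simp_all [add_comm]
  have h2 : ((Λ : ℝ) + 1 : ℂ) • (1 : Matrix ι ι ℂ) -
      (((Λ : ℝ) + 1 : ℂ) • Q (some x) + ((Λ : ℝ) : ℂ) • Q (some y)) =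
      ((Λ : ℝ) + 1 : ℂ) • Q none + Q (some y) := by
    rw [← hQ.2, h1]; module
  rw [h2]
  refine ((hQ.1 _).smul ?_).add (hQ.1 _)
  exact_mod_cast (by positivity : (0 : ℝ) ≤ Λ + 1)

section Bob

variable {W : Type} [Fintype W] [DecidableEq W]

lemma bobReward_eq (P : Protocol A M B) (Λ : ℝ≥0) (S : BobStrategy M W) : P.bobReward Λ S =
    (onAB M (P.rewardOpA Λ) (1 : Matrix W W ℂ) * P.bobCheatState S P.n).trace.re := by
  have h : onAB M (P.rewardOpA Λ) (1 : Matrix W W ℂ) =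
      ((Λ : ℝ) + 1 : ℂ) • onAB M (P.PiA (some 1)) (1 : Matrix W W ℂ) +
        ((Λ : ℝ) : ℂ) • onAB M (P.PiA (some 0)) (1 : Matrix W W ℂ) := by
    rw [onAB, rewardOpA, add_kronecker, smul_kronecker, smul_kronecker, onAB, onAB]
  rw [h, bobReward, Matrix.add_mul, Matrix.smul_mul, Matrix.smul_mul, trace_add, trace_smul, trace_smul,
    Complex.add_re, smul_eq_mul, smul_eq_mul, Complex.re_ofReal_mul, ← Complex.ofReal_one,
    ← Complex.ofReal_add, Complex.re_ofReal_mul]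

lemma bobCheatState_bound (hP : P.IsPenWCF) (S : BobStrategy M W) (i : ℕ) (hi : i ≤ P.n) :
    (P.bobCheatState S i).PosSemidef ∧ (P.bobCheatState S i).trace.re ≤ 1 := by
  induction i with
  | zero =>
    refine ⟨(ketbra_posSemidef _).kronecker ((ketbra_posSemidef _).kronecker S.density.1), ?_⟩
    rw [bobCheatState, trace_kronecker, trace_kronecker, trace_ketbra, trace_ketbra, hP.norm_psiA,
      hP.norm_psiM, S.density.2]
    simp
  | succ i ih =>
    obtain ⟨ih1, ih2⟩ := ih (by omega)
    rw [bobCheatState]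
    split_ifs with hodd
    · refine ⟨ih1.mul_mul_conjTranspose_same _, (trace_contraction_le ?_ ih1).trans ih2⟩
      rw [onAM_conjTranspose, ← onAM_mul, ← onAM_one, ← onAM_sub]
      exact onAM_posSemidef (one_sub_star_mul_self_posSemidef
        (hP.unitary_UA _ (by omega) hi hodd) (hP.proj_EA _ (by omega) hi hodd))
    · refine ⟨posSemidef_sum _ fun j _ => ih1.mul_mul_conjTranspose_same _, ?_⟩
      rw [trace_sum_kraus]
      · exact ih2
      · simp only [onMB_conjTranspose, ← onMB_mul]
        rw [← onMB_sum, (S.act (i + 1)).complete, onMB_one]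

lemma bobReward_le (hP : P.IsPenWCF) (Λ : ℝ≥0) (S : BobStrategy M W) :
    P.bobReward Λ S ≤ Λ + 1 := by
  obtain ⟨h1, h2⟩ := bobCheatState_bound hP S P.n le_rfl
  rw [bobReward_eq, onAB_one_right]
  refine (trace_mul_re_le (Y := onAM W ((((Λ : ℝ) + 1 : ℂ) • (1 : Matrix A A ℂ)) ⊗ₖ
    (1 : Matrix M M ℂ))) ?_ h1).trans ?_
  · have h4 : ∀ X Y : Matrix A A ℂ, X ⊗ₖ (1 : Matrix M M ℂ) - Y ⊗ₖ (1 : Matrix M M ℂ) =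
        (X - Y) ⊗ₖ (1 : Matrix M M ℂ) := by
      intro X Y; ext; simp [sub_mul]
    rw [← onAM_sub, h4]
    exact onAM_posSemidef (kronecker_one_posSemidef
      (sub_combination_posSemidef hP.povm_A Λ (by decide)))
  · have h3 : onAM W ((((Λ : ℝ) + 1 : ℂ) • (1 : Matrix A A ℂ)) ⊗ₖ (1 : Matrix M M ℂ)) =
        ((Λ : ℝ) + 1 : ℂ) • (1 : Matrix (A × M × W) (A × M × W) ℂ) := by
      rw [← onAB_one_right, onAB, smul_kronecker, one_kronecker_one, one_kronecker_one]
    rw [h3, Matrix.smul_mul, Matrix.one_mul, trace_smul, smul_eq_mul, ← Complex.ofReal_one,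
      ← Complex.ofReal_add, Complex.re_ofReal_mul]
    have : (0 : ℝ) ≤ Λ + 1 := by positivity
    nlinarith

/-- A real `sSup` is an upper bound only for sets bounded above; the bound `Λ + 1` over all
workspaces supplies this. -/
lemma bobReward_le_cheatingRewardB (hP : P.IsPenWCF) (Λ : ℝ≥0) (S : BobStrategy M W) :
    P.bobReward Λ S ≤ P.cheatingRewardB Λ := by
  refine le_csSup ⟨Λ + 1, ?_⟩ ⟨W, inferInstance, inferInstance, S, rfl⟩
  rintro _ ⟨W', _, _, S', rfl⟩
  exact bobReward_le hP Λ S'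

end Bob

section Alice

variable {W : Type} [Fintype W] [DecidableEq W]

lemma aliceReward_eq (P : Protocol A M B) (Λ : ℝ≥0) (S : AliceStrategy M W) : P.aliceReward Λ S =
    (onAB M (1 : Matrix W W ℂ) (P.rewardOpB Λ) * P.aliceCheatState S P.n).trace.re := by
  have h : onAB M (1 : Matrix W W ℂ) (P.rewardOpB Λ) =
      ((Λ : ℝ) + 1 : ℂ) • onAB M (1 : Matrix W W ℂ) (P.PiB (some 0)) +
        ((Λ : ℝ) : ℂ) • onAB M (1 : Matrix W W ℂ) (P.PiB (some 1)) := by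
    simp only [onAB, rewardOpB, kronecker_add, kronecker_smul]
  rw [h, aliceReward, Matrix.add_mul, Matrix.smul_mul, Matrix.smul_mul, trace_add, trace_smul, trace_smul,
    Complex.add_re, smul_eq_mul, smul_eq_mul, Complex.re_ofReal_mul, ← Complex.ofReal_one,
    ← Complex.ofReal_add, Complex.re_ofReal_mul]

lemma aliceCheatState_bound (hP : P.IsPenWCF) (S : AliceStrategy M W) (i : ℕ) (hi : i ≤ P.n) :
    (P.aliceCheatState S i).PosSemidef ∧ (P.aliceCheatState S i).trace.re ≤ 1 := by
  induction i with
  | zero =>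
    refine ⟨(S.density.1.kronecker (ketbra_posSemidef _)).submatrix _, ?_⟩
    have h : ∀ X : Matrix ((W × M) × B) ((W × M) × B) ℂ,
        (reindex (Equiv.prodAssoc W M B) (Equiv.prodAssoc W M B) X).trace = X.trace := fun X =>
      Equiv.sum_comp (Equiv.prodAssoc W M B).symm fun x => X x x
    rw [aliceCheatState, h, trace_kronecker, trace_ketbra, hP.norm_psiB, S.density.2]
    simp
  | succ i ih =>
    obtain ⟨ih1, ih2⟩ := ih (by omega)
    rw [aliceCheatState]
    split_ifs with hodd
    · refine ⟨posSemidef_sum _ fun j _ => ih1.mul_mul_conjTranspose_same _, ?_⟩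
      rw [trace_sum_kraus]
      · exact ih2
      · simp only [onAM_conjTranspose, ← onAM_mul]
        rw [← onAM_sum, (S.act (i + 1)).complete, onAM_one]
    · rw [Nat.not_odd_iff_even] at hodd
      refine ⟨ih1.mul_mul_conjTranspose_same _, (trace_contraction_le ?_ ih1).trans ih2⟩
      rw [onMB_conjTranspose, ← onMB_mul, ← onMB_one, ← onMB_sub]
      exact onMB_posSemidef (one_sub_star_mul_self_posSemidef
        (hP.unitary_UB _ (by omega) hi hodd) (hP.proj_EB _ (by omega) hi hodd))

lemma aliceReward_le (hP : P.IsPenWCF) (Λ : ℝ≥0) (S : AliceStrategy M W) :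
    P.aliceReward Λ S ≤ Λ + 1 := by
  obtain ⟨h1, h2⟩ := aliceCheatState_bound hP S P.n le_rfl
  rw [aliceReward_eq, onAB_one_left]
  refine (trace_mul_re_le (Y := onMB W ((1 : Matrix M M ℂ) ⊗ₖ
    (((Λ : ℝ) + 1 : ℂ) • (1 : Matrix B B ℂ)))) ?_ h1).trans ?_
  · have h4 : ∀ X Y : Matrix B B ℂ, (1 : Matrix M M ℂ) ⊗ₖ X - (1 : Matrix M M ℂ) ⊗ₖ Y =
        (1 : Matrix M M ℂ) ⊗ₖ (X - Y) := by
      intro X Y; ext; simp [mul_sub]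
    rw [← onMB_sub, h4]
    exact onMB_posSemidef (PosSemidef.one.kronecker
      (sub_combination_posSemidef hP.povm_B Λ (by decide)))
  · have h3 : onMB W ((1 : Matrix M M ℂ) ⊗ₖ (((Λ : ℝ) + 1 : ℂ) • (1 : Matrix B B ℂ))) =
        ((Λ : ℝ) + 1 : ℂ) • (1 : Matrix (W × M × B) (W × M × B) ℂ) := by
      rw [onMB, kronecker_smul, one_kronecker_one, kronecker_smul, one_kronecker_one]
    rw [h3, Matrix.smul_mul, Matrix.one_mul, trace_smul, smul_eq_mul, ← Complex.ofReal_one,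
      ← Complex.ofReal_add, Complex.re_ofReal_mul]
    have : (0 : ℝ) ≤ Λ + 1 := by positivity
    nlinarith

lemma aliceReward_le_cheatingRewardA (hP : P.IsPenWCF) (Λ : ℝ≥0) (S : AliceStrategy M W) :
    P.aliceReward Λ S ≤ P.cheatingRewardA Λ := by
  refine le_csSup ⟨Λ + 1, ?_⟩ ⟨W, inferInstance, inferInstance, S, rfl⟩
  rintro _ ⟨W', _, _, S', rfl⟩
  exact aliceReward_le hP Λ S'

end Alice

lemma nonempty_of_sqNorm_eq_one {ι : Type} [Fintype ι] {v : ι → ℂ} (h : sqNorm v = 1) :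
    Nonempty ι := by
  by_contra hn
  rw [not_nonempty_iff] at hn
  simp [sqNorm] at h

/-! ### Dual certificates -/

/-- A certificate that cheating Bob cannot gain `r` or more. -/
lemma exists_dual_alice (hP : P.IsPenWCF) {Λ : ℝ≥0} {r : ℝ} (hr : P.cheatingRewardB Λ < r) {m : ℕ}
    (hm : P.n = 2 * m + 2) :
    ∃ Z : ℕ → Matrix A A ℂ, Z m = P.rewardOpA Λ ∧ (∀ j ≤ m, (Z j).PosSemidef) ∧
      ((Z 0 ⊗ₖ (1 : Matrix M M ℂ)) * ketbra ((P.UA 1 * P.EA 1) *ᵥ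
        fun x => P.psiA x.1 * P.psiM x.2)).trace.re < r ∧
      ∀ j < m, (Z j ⊗ₖ (1 : Matrix M M ℂ) -
        (P.UA (2 * j + 3) * P.EA (2 * j + 3))ᴴ * (Z (j + 1) ⊗ₖ (1 : Matrix M M ℂ)) *
          (P.UA (2 * j + 3) * P.EA (2 * j + 3))).PosDef := by
  have := nonempty_of_sqNorm_eq_one hP.norm_psiA
  have := nonempty_of_sqNorm_eq_one hP.norm_psiM
  set V : ℕ → Matrix (A × M) (A × M) ℂ := fun j => P.UA (2 * j + 3) * P.EA (2 * j + 3) with hV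
  obtain ⟨e, he⟩ := exists_sqNorm_eq_one (A × M)
  set χ : A × M → ℂ := fun x => P.psiA x.1 * P.psiM x.2 with hχ
  set Φi : A × M × (A × M) → ℂ := fun x => P.psiA x.1 * (P.psiM x.2.1 * e x.2.2) with hΦi
  set Φ₀ : A × M × (A × M) → ℂ := onAM (A × M) (P.UA 1 * P.EA 1) *ᵥ Φi with hΦ₀
  have hZf : (P.rewardOpA Λ).PosSemidef := combination_posSemidef hP.povm_A Λ 1 0
  have hred : reduced Φ₀ = ketbra ((P.UA 1 * P.EA 1) *ᵥ χ) := by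
    rw [hΦ₀, reduced_onAM, ← mul_ketbra_mul]
    congr 2
    ext p q
    simp only [reduced, hΦi, ketbra, hχ, vecMulVec_apply, of_apply, Pi.star_apply, star_mul']
    rw [← mul_one (_ * _ * _), ← sum_mul_star_eq_one he, Finset.mul_sum]
    exact Finset.sum_congr rfl fun w _ => by ring
  -- Otherwise strong duality produces unitary responses, hence a strategy for Bob with reward at
  -- least `r`. The response `u j` is played in round `2 j + 2`, and `V j` is Alice's round `2 j +
  -- 3`.
  have key : ∃ X ∈ dualSet (P.rewardOpA Λ) m V, (X * ptrace (reduced Φ₀)).trace.re < r := by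
    by_contra! hcon
    obtain ⟨u, hu, hval⟩ := exists_strategy_of_forall_dualSet_le hZf m V Φ₀ hcon
    let S : BobStrategy M (A × M) :=
      { init := ketbra e
        density := isDensity_ketbra he
        act := fun i => unitaryChannel (u ((i - 2) / 2)) (hu _) }
    have hinit : P.bobCheatState S 0 = ketbra Φi := by
      ext x y
      simp only [bobCheatState, ketbra, hΦi, vecMulVec_apply, S, kroneckerMap_apply, Pi.star_apply,
        star_mul']
      ring
    have hstep : ∀ i v, ¬ Odd (i + 1) → P.bobCheatState S i = ketbra v →
        P.bobCheatState S (i + 1) = ketbra (onMB A (u ((i + 1 - 2) / 2)) *ᵥ v) := by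
      intro i v hi hv
      rw [bobCheatState, if_neg hi, hv]
      exact (sum_unitaryChannel (hu _) fun X => onMB A X * ketbra v * (onMB A X)ᴴ).trans
        (mul_ketbra_mul _ _)
    have hodd : ∀ j, P.bobCheatState S (2 * j + 1) = ketbra (pureState V u Φ₀ j) := by
      intro j
      induction j with
      | zero =>
        rw [bobCheatState, if_pos (by decide), hinit, mul_ketbra_mul]
        rfl
      | succ j ih =>
        rw [show 2 * (j + 1) + 1 = (2 * j + 1 + 1) + 1 by ring, bobCheatState,
          if_pos (by rw [Nat.odd_iff]; omega), hstep _ _ (by rw [Nat.odd_iff]; omega) ih,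
          mul_ketbra_mul, show (2 * j + 1 + 1 - 2) / 2 = j by omega]
        rfl
    have hfin : P.bobCheatState S P.n = ketbra (onMB A (u m) *ᵥ pureState V u Φ₀ m) := by
      rw [hm, hstep _ _ (by rw [Nat.odd_iff]; omega) (hodd m),
        show (2 * m + 1 + 1 - 2) / 2 = m by omega]
    -- Bob's last move in round `n` leaves Alice's workspace untouched, so it does not affect the
    -- reward.
    have hrew : P.bobReward Λ S =
        (P.rewardOpA Λ * ptrace (reduced (pureState V u Φ₀ m))).trace.re := by
      rw [bobReward_eq, hfin, trace_onAB_mul_ketbra, ptrace_reduced_onMB (hu m)]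
    have := bobReward_le_cheatingRewardB hP Λ S
    linarith
  obtain ⟨X, hX, hXr⟩ := key
  obtain ⟨Z, h0, hZm, hZ⟩ := exists_seq_of_mem_dualSet hX
  refine ⟨Z, hZm, ?_, ?_, hZ⟩
  · intro j hj
    induction hj using Nat.decreasingInduction with
    | self => rw [hZm]; exact hZf
    | of_succ k hk ih =>
      refine posSemidef_of_kronecker_one (M := M) ?_
      simpa using (hZ k hk).posSemidef.add
        ((kronecker_one_posSemidef (M := M) ih).conjTranspose_mul_mul_same (V k))
  · rw [trace_kronecker_one_mul, ← hred, h0]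
    exact hXr

/-- A certificate that cheating Alice cannot gain `r` or more. -/
lemma exists_dual_bob (hP : P.IsPenWCF) {Λ : ℝ≥0} {r : ℝ} (hr : P.cheatingRewardA Λ < r) {m : ℕ}
    (hm : P.n = 2 * m) :
    ∃ Z : ℕ → Matrix B B ℂ, Z m = P.rewardOpB Λ ∧ (∀ j ≤ m, (Z j).PosSemidef) ∧
      (Z 0 * ketbra P.psiB).trace.re < r ∧
      ∀ j < m, ((1 : Matrix M M ℂ) ⊗ₖ Z j -
        (P.UB (2 * j + 2) * P.EB (2 * j + 2))ᴴ * ((1 : Matrix M M ℂ) ⊗ₖ Z (j + 1)) *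
          (P.UB (2 * j + 2) * P.EB (2 * j + 2))).PosDef := by
  have := nonempty_of_sqNorm_eq_one hP.norm_psiB
  have := nonempty_of_sqNorm_eq_one hP.norm_psiM
  -- The factors are swapped because the duality lemmas place the honest party on the left.
  set V : ℕ → Matrix (B × M) (B × M) ℂ := fun j =>
    (P.UB (2 * j + 2) * P.EB (2 * j + 2)).submatrix Prod.swap Prod.swap with hV
  obtain ⟨e, he⟩ := exists_sqNorm_eq_one ((B × M) × M)
  -- Cheating Alice also prepares the message, so the initial `e` on workspace and message is
  -- arbitrary: only Bob's reduced state `|ψ_B⟩⟨ψ_B|` enters the dual value.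
  set Φ₀ : B × M × (B × M) → ℂ := fun x =>
    P.psiB x.1 * e (x.2.2, x.2.1) with hΦ₀
  have hZf : (P.rewardOpB Λ).PosSemidef := combination_posSemidef hP.povm_B Λ 0 1
  have hred : ptrace (reduced Φ₀) = ketbra P.psiB := by
    ext p q
    have h1 := sum_mul_star_eq_one he
    rw [Fintype.sum_prod_type_right] at h1
    simp only [ptrace, reduced, hΦ₀, ketbra, vecMulVec_apply, of_apply, Pi.star_apply, star_mul']
    rw [← mul_one (_ * _), ← h1, Finset.mul_sum]
    refine Finset.sum_congr rfl fun m _ => ?_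
    rw [Finset.mul_sum]
    exact Finset.sum_congr rfl fun w _ => by ring
  have key : ∃ X ∈ dualSet (P.rewardOpB Λ) m V, (X * ptrace (reduced Φ₀)).trace.re < r := by
    by_contra! hcon
    obtain ⟨u, hu, hval⟩ := exists_strategy_of_forall_dualSet_le hZf m V Φ₀ hcon
    have husw : ∀ j, (u j).submatrix Prod.swap Prod.swap ∈ unitaryGroup ((B × M) × M) ℂ := by
      intro j
      rw [mem_unitaryGroup_iff, star_eq_conjTranspose, conjTranspose_submatrix]
      have h1 : u j * (u j)ᴴ = 1 := mem_unitaryGroup_iff.1 (hu j)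
      exact (submatrix_mul_equiv _ _ _ (Equiv.prodComm _ _) _).trans (by
        rw [h1]; exact submatrix_one_equiv (Equiv.prodComm _ _))
    let S : AliceStrategy M (B × M) :=
      { init := ketbra e
        density := isDensity_ketbra he
        act := fun i => unitaryChannel ((u ((i - 1) / 2)).submatrix Prod.swap Prod.swap) (husw _) }
    have hstep : ∀ i v, Odd (i + 1) → P.aliceCheatState S i = ketbra v →
        P.aliceCheatState S (i + 1) = ketbra (onAM B
          ((u ((i + 1 - 1) / 2)).submatrix Prod.swap Prod.swap) *ᵥ v) := by
      intro i v hi hv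
      rw [aliceCheatState, if_pos hi, hv]
      exact (sum_unitaryChannel (husw _) fun X => onAM B X * ketbra v * (onAM B X)ᴴ).trans
        (mul_ketbra_mul _ _)
    have heven : ∀ j, P.aliceCheatState S (2 * j) = ketbra (rev (pureState V u Φ₀ j)) := by
      intro j
      induction j with
      | zero =>
        ext x y
        simp only [aliceCheatState, ketbra, hΦ₀, vecMulVec_apply, S, kroneckerMap_apply, rev,
          pureState, reindex_apply, submatrix_apply, Equiv.prodAssoc_symm_apply, Pi.star_apply,
          star_mul']
        ring
      | succ j ih =>
        rw [show 2 * (j + 1) = (2 * j + 1) + 1 by ring, aliceCheatState,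
          if_neg (by rw [Nat.odd_iff]; omega), hstep _ _ (by rw [Nat.odd_iff]; omega) ih,
          mul_ketbra_mul, onAM_mulVec_rev, onMB_mulVec_rev,
          show (2 * j + 1 - 1) / 2 = j by omega]
        rfl
    have hrew : P.aliceReward Λ S =
        (P.rewardOpB Λ * ptrace (reduced (pureState V u Φ₀ m))).trace.re := by
      rw [aliceReward_eq, hm, heven, trace_onAB_mul_ketbra_rev]
    have := aliceReward_le_cheatingRewardA hP Λ S
    linarith
  obtain ⟨X, hX, hXr⟩ := key
  obtain ⟨Z, h0, hZm, hZ⟩ := exists_seq_of_mem_dualSet hX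
  refine ⟨Z, hZm, ?_, ?_, fun j hj => ?_⟩
  · intro j hj
    induction hj using Nat.decreasingInduction with
    | self => rw [hZm]; exact hZf
    | of_succ k hk ih =>
      refine posSemidef_of_kronecker_one (M := M) ?_
      simpa using (hZ k hk).posSemidef.add
        ((kronecker_one_posSemidef (M := M) ih).conjTranspose_mul_mul_same (V k))
  · rw [← hred, h0]
    exact hXr
  · have hsw : ∀ Y : Matrix B B ℂ, (1 : Matrix M M ℂ) ⊗ₖ Y =
        (Y ⊗ₖ (1 : Matrix M M ℂ)).submatrix Prod.swap Prod.swap := by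
      intro Y; ext ⟨a, b⟩ ⟨c, d⟩; simp [mul_comm]
    have h1 := (hZ j hj).submatrix (e := Prod.swap) (Equiv.prodComm M B).injective
    convert! h1 using 1
    have h2 : ∀ X Y : Matrix (B × M) (B × M) ℂ, X.submatrix Prod.swap Prod.swap *
        Y.submatrix Prod.swap Prod.swap =
          ((X * Y).submatrix Prod.swap Prod.swap : Matrix (M × B) (M × B) ℂ) := fun X Y =>
      submatrix_mul_equiv _ _ _ (Equiv.prodComm _ _) _
    have h3 : P.UB (2 * j + 2) * P.EB (2 * j + 2) = (V j).submatrix Prod.swap Prod.swap := by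
      ext ⟨a, b⟩ ⟨c, d⟩; rfl
    rw [hsw, hsw, h3, conjTranspose_submatrix, h2, h2]
    rfl

end Protocol

/-! ### From certificates to point games -/

section Step

variable {ι : Type} [Fintype ι] [DecidableEq ι]

/-- A check `E` followed by a unitary `U`, both commuting with `Y`, takes `ψ` to `U ψ`, where `E`
never fails on `ψ` and `E U* X' U E < X`. -/
structure Step (X' X Y U E : Matrix ι ι ℂ) (ψ : ι → ℂ) : Prop where
  posSemidef : X'.PosSemidef
  isHermitian : Y.IsHermitian
  proj : IsStarProjection E
  unitary : U ∈ unitaryGroup ι ℂ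
  comm_E : E * Y = Y * E
  comm_U : U * Y = Y * U
  posDef : (X - E * (Uᴴ * X' * U) * E).PosDef
  fixed : E *ᵥ ψ = ψ

variable {X' X Y U E : Matrix ι ι ℂ} {ψ : ι → ℂ}

lemma Step.isEBMLine (h : Step X' X Y U E ψ) (y : ℝ≥0) :
    IsEBMLine (fun x => frame X' Y (WithLp.toLp 2 (U *ᵥ ψ)) (x, y))
      (fun x => frame X Y (WithLp.toLp 2 ψ) (x, y)) :=
  isEBMLine_frame h.posSemidef h.isHermitian h.proj (mem_unitaryGroup_iff'.1 h.unitary)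
    (mem_unitaryGroup_iff.1 h.unitary) h.comm_E h.comm_U h.posDef (ψ := WithLp.toLp 2 ψ)
    (congrArg (WithLp.toLp 2) h.fixed) y

lemma Step.isHermitian_left (h : Step X' X Y U E ψ) : X.IsHermitian :=
  isHermitian_of_sub_posDef (h.posSemidef.conjTranspose_mul_mul_same U) h.proj h.posDef

/-- Expectations grow when rounds are undone; this yields `Λ ≤ α` and `Λ ≤ β` in the end. -/
lemma Step.expect_le (h : Step X' X Y U E ψ) :
    (star (U *ᵥ ψ) ⬝ᵥ X' *ᵥ (U *ᵥ ψ)).re ≤ (star ψ ⬝ᵥ X *ᵥ ψ).re := by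
  have h1 := (Complex.nonneg_iff.1 (h.posDef.posSemidef.dotProduct_mulVec_nonneg ψ)).1
  have hE : Eᴴ = E := h.proj.isSelfAdjoint
  have h2 : star ψ ⬝ᵥ (E * (Uᴴ * X' * U) * E) *ᵥ ψ = star (U *ᵥ ψ) ⬝ᵥ X' *ᵥ (U *ᵥ ψ) := by
    rw [star_mulVec, ← dotProduct_mulVec, mulVec_mulVec, mulVec_mulVec, ← mulVec_mulVec _ _ E,
      h.fixed, ← mulVec_mulVec, dotProduct_mulVec]
    conv_lhs => rw [← hE, ← star_mulVec, h.fixed]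
  rw [sub_mulVec, dotProduct_sub, h2, Complex.sub_re] at h1
  linarith

lemma Step.expect_eq (h : Step X' X Y U E ψ) :
    star (U *ᵥ ψ) ⬝ᵥ Y *ᵥ (U *ᵥ ψ) = star ψ ⬝ᵥ Y *ᵥ ψ := by
  have hU : Uᴴ * U = 1 := mem_unitaryGroup_iff'.1 h.unitary
  rw [star_mulVec, ← dotProduct_mulVec, mulVec_mulVec, mulVec_mulVec, Matrix.mul_assoc,
    ← h.comm_U, ← Matrix.mul_assoc, hU, Matrix.one_mul]

lemma isEBMLine_refl {X : Matrix ι ι ℂ} (hX : X.PosSemidef) (Y : Matrix ι ι ℂ)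
    (ψ : EuclideanSpace ℂ ι) (y : ℝ≥0) :
    IsEBMLine (fun x => frame X Y ψ (x, y)) (fun x => frame X Y ψ (x, y)) :=
  ⟨ι, inferInstance, inferInstance, X, X, eigProj Y y ψ, hX, by rw [sub_self]; exact .zero,
    fun _ => frame_apply_prob _ _ _ _ _, fun _ => frame_apply_prob _ _ _ _ _⟩

lemma Step.isEBMHorizontal (h : Step X' X Y U E ψ) :
    IsEBMHorizontal (frame X' Y (WithLp.toLp 2 (U *ᵥ ψ))) (frame X Y (WithLp.toLp 2 ψ)) :=
  h.isEBMLine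

lemma Step.isEBMVertical (h : Step X' X Y U E ψ) (hc' : Y * X' = X' * Y) (hc : Y * X = X * Y) :
    IsEBMVertical (frame Y X' (WithLp.toLp 2 (U *ᵥ ψ))) (frame Y X (WithLp.toLp 2 ψ)) := by
  intro x
  simp only [frame_swap h.isHermitian h.posSemidef.1 hc',
    frame_swap h.isHermitian h.isHermitian_left hc]
  exact h.isEBMLine x

lemma isEBMVertical_refl (hX : X.IsHermitian) (hY : Y.PosSemidef) (hc : X * Y = Y * X)
    (ψ : EuclideanSpace ℂ ι) : IsEBMVertical (frame X Y ψ) (frame X Y ψ) := by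
  intro x
  simp only [frame_swap hX hY.1 hc]
  exact isEBMLine_refl hY X ψ x

lemma eigProj_mulVec {v : ι → ℂ} (hX : X.IsHermitian) {a : ℝ≥0} (hv : X *ᵥ v = ((a : ℝ) : ℂ) • v)
    (z : ℝ≥0) : eigProj X z (WithLp.toLp 2 v) = if z = a then WithLp.toLp 2 v else 0 :=
  eigProj_of_eigenvector hX (congrArg (WithLp.toLp 2) hv) z

lemma frame_of_eigenvector {v : ι → ℂ} (hX : X.IsHermitian) (hY : Y.IsHermitian) {a b : ℝ≥0}
    (hXv : X *ᵥ v = ((a : ℝ) : ℂ) • v) (hYv : Y *ᵥ v = ((b : ℝ) : ℂ) • v) (hv : sqNorm v = 1) :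
    frame X Y (WithLp.toLp 2 v) = point 1 a b := by
  have hn : ‖WithLp.toLp 2 v‖ ^ 2 = 1 := by rw [EuclideanSpace.norm_sq_eq]; exact hv
  ext ⟨x, y⟩
  rw [frame_apply, eigProj_mulVec hY hYv, point, Finsupp.single_apply]
  by_cases hy : y = b
  · rw [if_pos hy, eigProj_mulVec hX hXv]
    by_cases hx : x = a
    · simp [hx, hy, hn]
    · simp [hx, Ne.symm hx]
  · simp [hy, Ne.symm hy]

lemma frame_of_eigenvectors {v w : ι → ℂ} (hX : X.IsHermitian) (hY : Y.IsHermitian)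
    {a b c d : ℝ≥0} (hXv : X *ᵥ v = ((a : ℝ) : ℂ) • v) (hYv : Y *ᵥ v = ((b : ℝ) : ℂ) • v)
    (hXw : X *ᵥ w = ((c : ℝ) : ℂ) • w) (hYw : Y *ᵥ w = ((d : ℝ) : ℂ) • w) (hac : a ≠ c)
    (hbd : b ≠ d) (hv : sqNorm v = 1 / 2) (hw : sqNorm w = 1 / 2) :
    frame X Y (WithLp.toLp 2 (v + w)) = point (1 / 2) a b + point (1 / 2) c d := by
  have hnv : ‖WithLp.toLp 2 v‖ ^ 2 = 1 / 2 := by rw [EuclideanSpace.norm_sq_eq]; exact hv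
  have hnw : ‖WithLp.toLp 2 w‖ ^ 2 = 1 / 2 := by rw [EuclideanSpace.norm_sq_eq]; exact hw
  ext ⟨x, y⟩
  rw [frame_apply, WithLp.toLp_add, map_add, eigProj_mulVec hY hYv, eigProj_mulVec hY hYw, point,
    point, Finsupp.add_apply, Finsupp.single_apply, Finsupp.single_apply, map_add]
  by_cases hy : y = b
  · subst hy
    rw [if_pos rfl, if_neg hbd, eigProj_mulVec hX hXv, map_zero, add_zero]
    by_cases hx : x = a
    · subst hx; simp [hnv, hac.symm]
    · simp [hx, Ne.symm hx, hbd.symm]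
  · by_cases hy' : y = d
    · subst hy'
      rw [if_neg hbd.symm, if_pos rfl, eigProj_mulVec hX hXw, map_zero, zero_add]
      by_cases hx : x = c
      · subst hx; simp [hnw, hac]
      · simp [hx, Ne.symm hx, hbd]
    · simp [hy, hy', Ne.symm hy, Ne.symm hy']

/-- Perfectly correlated outcomes: the components of the state are eigenvectors. -/
lemma correlated_outcomes {P Q : Outcome → Matrix ι ι ℂ} (hP : ∑ a, P a = 1) (hQ : ∑ a, Q a = 1)
    (hcomm : ∀ a b, P a * Q b = Q b * P a)
    (h : ∀ a b : Outcome, ¬ (a = b ∧ a ≠ none) → (P a * Q b) *ᵥ ψ = 0) :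
    (P (some 0) * Q (some 0)) *ᵥ ψ + (P (some 1) * Q (some 1)) *ᵥ ψ = ψ ∧
      (∀ c, P c *ᵥ ψ = (P c * Q c) *ᵥ ψ) ∧ (∀ c, Q c *ᵥ ψ = (P c * Q c) *ᵥ ψ) ∧
      (∀ a c, P a *ᵥ ((P c * Q c) *ᵥ ψ) = if a = c then (P c * Q c) *ᵥ ψ else 0) ∧
      ∀ a c, Q a *ᵥ ((P c * Q c) *ᵥ ψ) = if a = c then (P c * Q c) *ᵥ ψ else 0 := by
  have hPc : ∀ c, P c *ᵥ ψ = (P c * Q c) *ᵥ ψ := by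
    intro c
    -- After inserting the other party's resolution of the identity, only the diagonal term survives
    -- on `ψ`.
    conv_lhs => rw [← Matrix.mul_one (P c), ← hQ, Finset.mul_sum, sum_mulVec]
    exact Finset.sum_eq_single c (fun b _ hb => h c b fun h' => hb h'.1.symm) (by simp)
  have hQc : ∀ c, Q c *ᵥ ψ = (P c * Q c) *ᵥ ψ := by
    intro c
    conv_lhs => rw [← Matrix.one_mul (Q c), ← hP, Finset.sum_mul, sum_mulVec]
    exact Finset.sum_eq_single c (fun b _ hb => h b c fun h' => hb h'.1) (by simp)
  have hPne : ∀ a c, a ≠ c → P a *ᵥ ((P c * Q c) *ᵥ ψ) = 0 := fun a c hac => by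
    rw [← hQc, mulVec_mulVec, h a c fun h' => hac h'.1]
  have hQne : ∀ a c, a ≠ c → Q a *ᵥ ((P c * Q c) *ᵥ ψ) = 0 := fun a c hac => by
    rw [← hPc, mulVec_mulVec, ← hcomm, h c a fun h' => hac h'.1.symm]
  refine ⟨?_, hPc, hQc, fun a c => ?_, fun a c => ?_⟩
  · have h1 : ∑ a, P a *ᵥ ψ = ψ := by rw [← sum_mulVec, hP, one_mulVec]
    rw [Fintype.sum_option, Fin.sum_univ_two, hPc none, h none none (by simp), zero_add, hPc, hPc]
      at h1
    exact h1
  · split_ifs with hac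
    · subst hac
      -- POVM elements need not be projections. `P a` fixes this vector because all other outcomes
      -- kill it.
      conv_rhs => rw [← one_mulVec ((P a * Q a) *ᵥ ψ), ← hP, sum_mulVec]
      exact (Finset.sum_eq_single a (fun b _ hb => hPne b a hb) (by simp)).symm
    · exact hPne a c hac
  · split_ifs with hac
    · subst hac
      conv_rhs => rw [← one_mulVec ((P a * Q a) *ᵥ ψ), ← hQ, sum_mulVec]
      exact (Finset.sum_eq_single a (fun b _ hb => hQne b a hb) (by simp)).symm
    · exact hQne a c hac

/-- `⟨ψ, v⟩ = ⟨ψ, T v⟩ = ⟨T ψ, v⟩ = ⟨v, v⟩`. -/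
lemma dotProduct_eq_sqNorm_of_fixed {T : Matrix ι ι ℂ} (hT : T.IsHermitian) {v : ι → ℂ}
    (hv : T *ᵥ ψ = v) (hTv : T *ᵥ v = v) : star ψ ⬝ᵥ v = (sqNorm v : ℂ) := by
  rw [← trace_ketbra, ketbra, trace_vecMulVec, dotProduct_comm v]
  conv_rhs => rw [← hv, star_mulVec, hT.eq, ← dotProduct_mulVec, hv, hTv]

lemma ketbra_mulVec {v : ι → ℂ} (hv : sqNorm v = 1) : ketbra v *ᵥ v = v := by
  have h := trace_ketbra v
  rw [hv, Complex.ofReal_one, ketbra, trace_vecMulVec, dotProduct_comm] at h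
  rw [ketbra, vecMulVec_mulVec, h]
  simp

lemma isStarProjection_ketbra {v : ι → ℂ} (hv : sqNorm v = 1) : IsStarProjection (ketbra v) := by
  refine ⟨?_, (ketbra_posSemidef v).1⟩
  have h := ketbra_mulVec hv
  change ketbra v * ketbra v = ketbra v
  conv_lhs => rw [ketbra, mul_vecMulVec, ← ketbra, h]
  rfl

/-- With `g = ⟨v, G v⟩` the matrix is `(r - g) 1 + g (1 - |v⟩⟨v|)`. Taking `|v⟩⟨v|` as the check
allows a scalar operator at time `0`. -/
lemma smul_one_sub_ketbra_posDef {v : ι → ℂ} (hv : sqNorm v = 1) {G : Matrix ι ι ℂ}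
    (hG : G.PosSemidef) {r : ℝ} (hr : (G * ketbra v).trace.re < r) :
    ((r : ℂ) • (1 : Matrix ι ι ℂ) - ketbra v * G * ketbra v).PosDef := by
  have h0 := hG.dotProduct_mulVec_nonneg v
  rw [← trace_mul_vecMulVec, ← ketbra] at h0
  set g := (G * ketbra v).trace with hg
  have h1 : ketbra v * G * ketbra v = g • ketbra v := by
    rw [Matrix.mul_assoc, ketbra, mul_vecMulVec, vecMulVec_mul_vecMulVec, hg, ketbra,
      trace_mul_vecMulVec]
    ext; simp [vecMulVec_apply]; ring
  have hp := isStarProjection_ketbra hv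
  have h2 : (1 - ketbra v).PosSemidef := by
    have h3 : 1 - ketbra v = (1 - ketbra v)ᴴ * (1 - ketbra v) := by
      have h4 : (ketbra v)ᴴ = ketbra v := hp.isSelfAdjoint
      have h5 : ketbra v * ketbra v = ketbra v := hp.isIdempotentElem
      simp [h4, sub_mul, mul_sub, h5]
    rw [h3]
    exact posSemidef_conjTranspose_mul_self _
  have h3 : (r : ℂ) • (1 : Matrix ι ι ℂ) - ketbra v * G * ketbra v =
      ((r : ℂ) - g) • (1 : Matrix ι ι ℂ) + g • (1 - ketbra v) := by
    rw [h1]; module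
  rw [h3]
  refine (PosDef.one.smul ?_).add_posSemidef (h2.smul h0)
  have h4 := Complex.nonneg_iff.1 h0
  rw [Complex.pos_iff]
  simp [← h4.2, hr]

end Step

/-! ### Rounds of a protocol as instances of `Step`. -/

section Tensor

variable {A M B : Type} [Fintype A] [DecidableEq A] [Fintype M] [DecidableEq M]
  [Fintype B] [DecidableEq B]

lemma onAM_mul_onAB (T : Matrix (A × M) (A × M) ℂ) (Z : Matrix B B ℂ) :
    onAM B T * onAB M (1 : Matrix A A ℂ) Z = onAB M (1 : Matrix A A ℂ) Z * onAM B T := by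
  rw [onAM, onAB, ← kronecker_assoc, one_kronecker_one, reindex_apply, reindex_apply,
    submatrix_mul_equiv, submatrix_mul_equiv, ← mul_kronecker_mul, ← mul_kronecker_mul]
  simp

lemma onMB_mul_onAB (T : Matrix (M × B) (M × B) ℂ) (Z : Matrix A A ℂ) :
    onMB A T * onAB M Z (1 : Matrix B B ℂ) = onAB M Z (1 : Matrix B B ℂ) * onMB A T := by
  rw [onMB, onAB, one_kronecker_one, ← mul_kronecker_mul, ← mul_kronecker_mul]
  simp

lemma onAB_eq_mul (X : Matrix A A ℂ) (Y : Matrix B B ℂ) :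
    onAB M X Y = onAB M X (1 : Matrix B B ℂ) * onAB M (1 : Matrix A A ℂ) Y := by
  rw [onAB, onAB, onAB, ← mul_kronecker_mul, ← mul_kronecker_mul]
  simp

lemma onAB_comm (X : Matrix A A ℂ) (Y : Matrix B B ℂ) :
    onAB M X (1 : Matrix B B ℂ) * onAB M (1 : Matrix A A ℂ) Y =
      onAB M (1 : Matrix A A ℂ) Y * onAB M X (1 : Matrix B B ℂ) := by
  rw [onAB_one_left]
  exact (onMB_mul_onAB _ _).symm

lemma isStarProjection_onAM {E : Matrix (A × M) (A × M) ℂ} (hE : IsStarProjection E) :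
    IsStarProjection (onAM B E) := by
  refine ⟨?_, ?_⟩
  · change onAM B E * onAM B E = _
    rw [← onAM_mul, show E * E = E from hE.isIdempotentElem]
  · change (onAM B E)ᴴ = _
    rw [onAM_conjTranspose, show Eᴴ = E from hE.isSelfAdjoint]

lemma isStarProjection_onMB {E : Matrix (M × B) (M × B) ℂ} (hE : IsStarProjection E) :
    IsStarProjection (onMB A E) := by
  refine ⟨?_, ?_⟩
  · change onMB A E * onMB A E = _
    rw [← onMB_mul, show E * E = E from hE.isIdempotentElem]
  · change (onMB A E)ᴴ = _
    rw [onMB_conjTranspose, show Eᴴ = E from hE.isSelfAdjoint]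

lemma onAM_unitary {U : Matrix (A × M) (A × M) ℂ} (hU : U ∈ unitaryGroup (A × M) ℂ) :
    onAM B U ∈ unitaryGroup (A × M × B) ℂ := by
  rw [mem_unitaryGroup_iff, star_eq_conjTranspose, onAM_conjTranspose, ← onAM_mul,
    ← star_eq_conjTranspose, mem_unitaryGroup_iff.1 hU, onAM_one]

lemma onMB_unitary {U : Matrix (M × B) (M × B) ℂ} (hU : U ∈ unitaryGroup (M × B) ℂ) :
    onMB A U ∈ unitaryGroup (A × M × B) ℂ := by
  rw [mem_unitaryGroup_iff, star_eq_conjTranspose, onMB_conjTranspose, ← onMB_mul,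
    ← star_eq_conjTranspose, mem_unitaryGroup_iff.1 hU, onMB_one]

lemma step_alice {Z' Z : Matrix A A ℂ} {Y : Matrix B B ℂ} {U E : Matrix (A × M) (A × M) ℂ}
    {ψ : A × M × B → ℂ} (hZ' : Z'.PosSemidef) (hY : Y.PosSemidef)
    (hE : IsStarProjection E) (hU : U ∈ unitaryGroup (A × M) ℂ)
    (h : (Z ⊗ₖ (1 : Matrix M M ℂ) - E * (Uᴴ * (Z' ⊗ₖ (1 : Matrix M M ℂ)) * U) * E).PosDef)
    (hψ : onAM B E *ᵥ ψ = ψ) :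
    Step (onAB M Z' (1 : Matrix B B ℂ)) (onAB M Z (1 : Matrix B B ℂ))
      (onAB M (1 : Matrix A A ℂ) Y) (onAM B U) (onAM B E) ψ where
  posSemidef := hZ'.kronecker (PosSemidef.one.kronecker PosSemidef.one)
  isHermitian := (PosSemidef.one.kronecker (PosSemidef.one.kronecker hY)).1
  proj := isStarProjection_onAM hE
  unitary := onAM_unitary hU
  comm_E := onAM_mul_onAB _ _
  comm_U := onAM_mul_onAB _ _
  posDef := by
    rw [onAB_one_right, onAB_one_right, onAM_conjTranspose, ← onAM_mul, ← onAM_mul, ← onAM_mul,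
      ← onAM_mul, ← onAM_sub]
    exact onAM_posDef h
  fixed := hψ

lemma step_bob {Z' Z : Matrix B B ℂ} {X : Matrix A A ℂ} {U E : Matrix (M × B) (M × B) ℂ}
    {ψ : A × M × B → ℂ} (hZ' : Z'.PosSemidef) (hX : X.PosSemidef)
    (hE : IsStarProjection E) (hU : U ∈ unitaryGroup (M × B) ℂ)
    (h : ((1 : Matrix M M ℂ) ⊗ₖ Z - E * (Uᴴ * ((1 : Matrix M M ℂ) ⊗ₖ Z') * U) * E).PosDef)
    (hψ : onMB A E *ᵥ ψ = ψ) :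
    Step (onAB M (1 : Matrix A A ℂ) Z') (onAB M (1 : Matrix A A ℂ) Z)
      (onAB M X (1 : Matrix B B ℂ)) (onMB A U) (onMB A E) ψ where
  posSemidef := PosSemidef.one.kronecker (PosSemidef.one.kronecker hZ')
  isHermitian := (hX.kronecker (PosSemidef.one.kronecker PosSemidef.one)).1
  proj := isStarProjection_onMB hE
  unitary := onMB_unitary hU
  comm_E := onMB_mul_onAB _ _
  comm_U := onMB_mul_onAB _ _
  posDef := by
    rw [onAB_one_left, onAB_one_left, onMB_conjTranspose, ← onMB_mul, ← onMB_mul, ← onMB_mul,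
      ← onMB_mul, ← onMB_sub]
    exact onMB_posDef h
  fixed := hψ

end Tensor

/-! ### The honest run: its two ends and its steps. -/

namespace Protocol

variable {A M B : Type} [Fintype A] [DecidableEq A] [Fintype M] [DecidableEq M]
  [Fintype B] [DecidableEq B] {P : Protocol A M B}

lemma exists_ne_zero_of_sqNorm_eq_one {ι : Type} [Fintype ι] {v : ι → ℂ} (h : sqNorm v = 1) :
    ∃ i, v i ≠ 0 := by
  by_contra! hn
  simp [sqNorm, hn] at h

lemma onAM_mulVec_honest_zero (T : Matrix (A × M) (A × M) ℂ) (x : A × M × B) :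
    (onAM B T *ᵥ P.honest 0) x =
      (T *ᵥ fun p => P.psiA p.1 * P.psiM p.2) (x.1, x.2.1) * P.psiB x.2.2 := by
  obtain ⟨a, m, b⟩ := x
  rw [onAM_mulVec_apply, mulVec, dotProduct, Finset.sum_mul]
  exact Finset.sum_congr rfl fun p _ => (mul_assoc _ _ _).symm

lemma onMB_mulVec_honest_zero (T : Matrix B B ℂ) :
    onMB A ((1 : Matrix M M ℂ) ⊗ₖ T) *ᵥ P.honest 0 =
      fun x => P.psiA x.1 * P.psiM x.2.1 * (T *ᵥ P.psiB) x.2.2 := by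
  ext ⟨a, m, b⟩
  rw [onMB_mulVec_apply, mulVec, dotProduct, Finset.mul_sum, Fintype.sum_prod_type,
    Finset.sum_eq_single m]
  · refine Finset.sum_congr rfl fun b' _ => ?_
    simp [honest]; ring
  · intro m' _ hm'
    simp [one_apply, hm'.symm]
  · simp

lemma sqNorm_psiA_psiM (hP : P.IsPenWCF) :
    sqNorm (fun p : A × M => P.psiA p.1 * P.psiM p.2) = 1 := by
  have h1 := hP.norm_psiA
  have h2 := hP.norm_psiM
  rw [sqNorm] at h1 h2 ⊢
  have h3 := congrArg₂ (· * ·) h1 h2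
  simp only [Finset.sum_mul_sum, mul_one] at h3
  rw [Fintype.sum_prod_type]
  simpa [mul_pow] using h3

/-- A product state cannot produce perfectly correlated fair coins. -/
lemma n_ne_zero (hP : P.IsPenWCF) : P.n ≠ 0 := by
  intro hn
  have hprod : ∀ a b (x : A × M × B), (onAB M (P.PiA a) (P.PiB b) *ᵥ P.honest 0) x =
      (P.PiA a *ᵥ P.psiA) x.1 * P.psiM x.2.1 * (P.PiB b *ᵥ P.psiB) x.2.2 := by
    intro a b x
    rw [onAB_eq_mul, ← mulVec_mulVec, onAB_one_left, onMB_mulVec_honest_zero, onAB_one_right]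
    obtain ⟨a', m, b'⟩ := x
    rw [onAM_mulVec_apply, mulVec, dotProduct, Finset.sum_mul, Finset.sum_mul,
      Fintype.sum_prod_type]
    refine Finset.sum_congr rfl fun a'' _ => ?_
    rw [Finset.sum_eq_single m]
    · simp; ring
    · intro m' _ hm'
      simp [one_apply, hm'.symm]
    · simp
  have hbal : ∀ x : Fin 2, ∃ y, (onAB M (P.PiA (some x)) (P.PiB (some x)) *ᵥ P.honest 0) y ≠ 0 := by
    intro x
    by_contra! h
    have := hP.balanced x
    simp [hn, sqNorm, h] at this
  obtain ⟨y, hy⟩ := hbal 0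
  obtain ⟨z, hz⟩ := hbal 1
  rw [hprod] at hy hz
  -- Amplitudes factor, so Alice's and the message's coordinates from outcome `(0,0)` with Bob's
  -- from `(1,1)` give a nonzero amplitude for the forbidden `(0,1)`.
  have h := congrFun (hP.correct (some 0) (some 1) (by simp)) (y.1, y.2.1, z.2.2)
  rw [hn, hprod] at h
  simp_all

/-- Bob's operator gives the first coordinate. The component where both output `0` has eigenvalues
`(Λ + 1, Λ)`, the other `(Λ, Λ + 1)`. The expectations start the bounds `Λ ≤ α`, `Λ ≤ β`. -/
lemma honest_final (hP : P.IsPenWCF) (Λ : ℝ≥0) :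
    frame (onAB M (1 : Matrix A A ℂ) (P.rewardOpB Λ)) (onAB M (P.rewardOpA Λ) (1 : Matrix B B ℂ))
        (WithLp.toLp 2 (P.honest P.n)) = point (1 / 2) Λ (Λ + 1) + point (1 / 2) (Λ + 1) Λ ∧
      (star (P.honest P.n) ⬝ᵥ onAB M (1 : Matrix A A ℂ) (P.rewardOpB Λ) *ᵥ P.honest P.n).re =
        Λ + 1 / 2 ∧
      (star (P.honest P.n) ⬝ᵥ onAB M (P.rewardOpA Λ) (1 : Matrix B B ℂ) *ᵥ P.honest P.n).re =
        Λ + 1 / 2 := by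
  set ψ := P.honest P.n with hψ
  set Q : Outcome → Matrix (A × M × B) (A × M × B) ℂ := fun a => onAB M (P.PiA a) 1 with hQ
  set R : Outcome → Matrix (A × M × B) (A × M × B) ℂ := fun b => onAB M 1 (P.PiB b) with hR
  have hQH : ∀ a, (Q a).IsHermitian := fun a =>
    ((hP.povm_A.1 a).kronecker (PosSemidef.one.kronecker PosSemidef.one)).1
  have hRH : ∀ a, (R a).IsHermitian := fun a =>
    (PosSemidef.one.kronecker (PosSemidef.one.kronecker (hP.povm_B.1 a))).1
  have hQ1 : ∑ a, Q a = 1 := by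
    have : onAB M (∑ a, P.PiA a) (1 : Matrix B B ℂ) = ∑ a, Q a := by
      ext; simp [onAB, hQ, Matrix.sum_apply]; ring
    rw [← this, hP.povm_A.2, onAB, one_kronecker_one, one_kronecker_one]
  have hR1 : ∑ a, R a = 1 := by
    have : onAB M (1 : Matrix A A ℂ) (∑ a, P.PiB a) = ∑ a, R a := by
      ext; simp [onAB, hR, Matrix.sum_apply]; ring
    rw [← this, hP.povm_B.2, onAB, one_kronecker_one, one_kronecker_one]
  have hQR : ∀ a b, onAB M (P.PiA a) (P.PiB b) = Q a * R b := fun a b => onAB_eq_mul _ _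
  obtain ⟨hsum, hQψ, hRψ, hQv, hRv⟩ := correlated_outcomes (ψ := ψ) hQ1 hR1
    (fun a b => onAB_comm _ _) (fun a b h => by rw [← hQR]; exact hP.correct a b h)
  have hbal : ∀ x : Fin 2, sqNorm ((Q (some x) * R (some x)) *ᵥ ψ) = 1 / 2 := fun x => by
    rw [← hQR]; exact hP.balanced x
  set v := (Q (some 0) * R (some 0)) *ᵥ ψ with hv
  set w := (Q (some 1) * R (some 1)) *ᵥ ψ with hw
  have hXe : onAB M (1 : Matrix A A ℂ) (P.rewardOpB Λ) =
      ((Λ : ℝ) + 1 : ℂ) • R (some 0) + ((Λ : ℝ) : ℂ) • R (some 1) := by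
    simp only [onAB, rewardOpB, kronecker_add, kronecker_smul, hR]
  have hYe : onAB M (P.rewardOpA Λ) (1 : Matrix B B ℂ) =
      ((Λ : ℝ) + 1 : ℂ) • Q (some 1) + ((Λ : ℝ) : ℂ) • Q (some 0) := by
    simp only [onAB, rewardOpA, add_kronecker, smul_kronecker, hQ]
  have hXv : onAB M (1 : Matrix A A ℂ) (P.rewardOpB Λ) *ᵥ v = (((Λ + 1 : ℝ≥0) : ℝ) : ℂ) • v := by
    rw [hXe, add_mulVec, smul_mulVec, smul_mulVec, hRv, hRv]; simp; rfl
  have hXw : onAB M (1 : Matrix A A ℂ) (P.rewardOpB Λ) *ᵥ w = ((Λ : ℝ) : ℂ) • w := by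
    rw [hXe, add_mulVec, smul_mulVec, smul_mulVec, hRv, hRv]; simp; rfl
  have hYv : onAB M (P.rewardOpA Λ) (1 : Matrix B B ℂ) *ᵥ v = ((Λ : ℝ) : ℂ) • v := by
    rw [hYe, add_mulVec, smul_mulVec, smul_mulVec, hQv, hQv]; simp; rfl
  have hYw : onAB M (P.rewardOpA Λ) (1 : Matrix B B ℂ) *ᵥ w = (((Λ + 1 : ℝ≥0) : ℝ) : ℂ) • w := by
    rw [hYe, add_mulVec, smul_mulVec, smul_mulVec, hQv, hQv]; simp; rfl
  have hXH : (onAB M (1 : Matrix A A ℂ) (P.rewardOpB Λ)).IsHermitian :=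
    (PosSemidef.one.kronecker (PosSemidef.one.kronecker
      (combination_posSemidef hP.povm_B Λ 0 1))).1
  have hYH : (onAB M (P.rewardOpA Λ) (1 : Matrix B B ℂ)).IsHermitian :=
    ((combination_posSemidef hP.povm_A Λ 1 0).kronecker
      (PosSemidef.one.kronecker PosSemidef.one)).1
  have hne : Λ + 1 ≠ Λ := by simp
  have hψv : star ψ ⬝ᵥ v = ((1 / 2 : ℝ) : ℂ) := by
    rw [← hbal 0]
    exact dotProduct_eq_sqNorm_of_fixed (hQH _) (hQψ _) (by rw [hQv, if_pos rfl])
  have hψw : star ψ ⬝ᵥ w = ((1 / 2 : ℝ) : ℂ) := by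
    rw [← hbal 1]
    exact dotProduct_eq_sqNorm_of_fixed (hQH _) (hQψ _) (by rw [hQv, if_pos rfl])
  refine ⟨?_, ?_, ?_⟩
  · rw [← hsum, frame_of_eigenvectors hXH hYH hXv hYv hXw hYw hne hne.symm (hbal 0) (hbal 1),
      add_comm]
  · have h1 : star ψ ⬝ᵥ onAB M (1 : Matrix A A ℂ) (P.rewardOpB Λ) *ᵥ ψ =
        (((Λ + 1 : ℝ) * (1 / 2) + Λ * (1 / 2) : ℝ) : ℂ) := by
      conv_lhs => rw [← hsum, mulVec_add, hXv, hXw, hsum, dotProduct_add, dotProduct_smul,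
        dotProduct_smul, hψv, hψw]
      push_cast; simp
    rw [h1, Complex.ofReal_re]; ring
  · have h1 : star ψ ⬝ᵥ onAB M (P.rewardOpA Λ) (1 : Matrix B B ℂ) *ᵥ ψ =
        ((Λ * (1 / 2) + (Λ + 1 : ℝ) * (1 / 2) : ℝ) : ℂ) := by
      conv_lhs => rw [← hsum, mulVec_add, hYv, hYw, hsum, dotProduct_add, dotProduct_smul,
        dotProduct_smul, hψv, hψw]
      push_cast; simp
    rw [h1, Complex.ofReal_re]; ring

lemma conjTranspose_mul_proj_mul {ι : Type} [Fintype ι] [DecidableEq ι] {U E : Matrix ι ι ℂ}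
    (hE : IsStarProjection E) (Z : Matrix ι ι ℂ) :
    (U * E)ᴴ * Z * (U * E) = E * (Uᴴ * Z * U) * E := by
  rw [conjTranspose_mul, show Eᴴ = E from hE.isSelfAdjoint]
  simp only [Matrix.mul_assoc]

/-- Alice's operators along the rounds, from the certificate against cheating Bob. -/
lemma exists_steps_alice (hP : P.IsPenWCF) {Λ r : ℝ≥0} (hr : P.cheatingRewardB Λ < r) :
    ∃ Z : ℕ → Matrix A A ℂ, Z P.n = P.rewardOpA Λ ∧ Z 0 = ((r : ℝ) : ℂ) • 1 ∧
      (∀ i ≤ P.n, (Z i).PosSemidef) ∧ (∀ i < P.n, Odd i → Z (i + 1) = Z i) ∧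
      ∀ i < P.n, Even i → ∀ Y : Matrix B B ℂ, Y.PosSemidef → ∃ E,
        Step (onAB M (Z (i + 1)) (1 : Matrix B B ℂ)) (onAB M (Z i) (1 : Matrix B B ℂ))
          (onAB M (1 : Matrix A A ℂ) Y) (P.U (i + 1)) E (P.honest i) := by
  obtain ⟨m, hm⟩ : ∃ m, P.n = 2 * m + 2 := by
    obtain ⟨k, hk⟩ := hP.even_n
    have := n_ne_zero hP
    exact ⟨k - 1, by omega⟩
  obtain ⟨Z, hZm, hZpos, hZ0, hZ⟩ := exists_dual_alice hP hr hm
  -- The index `(i - 1) / 2` advances exactly when `i` passes from `2 j + 2` to `2 j + 3`, Alice's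
  -- round; time `0` gets the scalar `r`.
  refine ⟨fun i => if i = 0 then ((r : ℝ) : ℂ) • 1 else Z ((i - 1) / 2), ?_, rfl, ?_, ?_, ?_⟩
  · simp only
    rw [if_neg (by omega), hm, show (2 * m + 2 - 1) / 2 = m by omega, hZm]
  · intro i hi
    simp only
    split_ifs with h0
    · exact PosSemidef.one.smul (by exact_mod_cast r.2)
    · exact hZpos _ (by omega)
  · rintro i hi ⟨k, rfl⟩
    simp only
    rw [if_neg (by omega), if_neg (by omega)]
    congr 1
    omega
  · rintro i hi hev Y hY
    have hodd : Odd (i + 1) := hev.add_one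
    have hU := hP.unitary_UA (i + 1) (by omega) (by omega) hodd
    have hEp := hP.proj_EA (i + 1) (by omega) (by omega) hodd
    have hEψ := hP.honest_E i hi
    rw [E, if_pos hodd] at hEψ
    rw [U, if_pos hodd]
    simp only
    rw [if_neg (by omega)]
    by_cases h0 : i = 0
    · subst h0
      set χ : A × M → ℂ := fun p => P.psiA p.1 * P.psiM p.2 with hχ
      have hχ1 : sqNorm χ = 1 := sqNorm_psiA_psiM hP
      have hEχ : P.EA 1 *ᵥ χ = χ := by
        obtain ⟨b, hb⟩ := exists_ne_zero_of_sqNorm_eq_one hP.norm_psiB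
        ext ⟨a, m⟩
        have h1 := congrFun hEψ (a, m, b)
        rw [onAM_mulVec_honest_zero] at h1
        exact mul_right_cancel₀ hb h1
      rw [if_pos rfl]
      -- In round 1 the protocol's check is replaced by the finer projection onto `ψ_A ⊗ ψ_M`.
      refine ⟨_, step_alice (E := ketbra χ) (hZpos 0 (by omega)) hY (isStarProjection_ketbra hχ1)
        hU ?_ ?_⟩
      · rw [smul_kronecker, one_kronecker_one]
        refine smul_one_sub_ketbra_posDef hχ1
          ((kronecker_one_posSemidef (hZpos 0 (by omega))).conjTranspose_mul_mul_same _) ?_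
        rw [← mulVec_mulVec, hEχ, ← mul_ketbra_mul, trace_mul_comm, Matrix.mul_assoc,
          Matrix.mul_assoc, trace_mul_comm, Matrix.mul_assoc, trace_mul_comm] at hZ0
        exact hZ0
      · ext ⟨a, m, b⟩
        rw [onAM_mulVec_honest_zero, ketbra_mulVec hχ1]
        rfl
    · obtain ⟨j, rfl⟩ : ∃ j, i = 2 * j + 2 := by
        obtain ⟨k, hk⟩ := hev
        exact ⟨k - 1, by omega⟩
      have h1 := hZ j (by omega)
      rw [if_neg h0]
      rw [conjTranspose_mul_proj_mul hEp] at h1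
      rw [show (2 * j + 2 + 1 - 1) / 2 = j + 1 by omega, show (2 * j + 2 - 1) / 2 = j by omega]
      exact ⟨_, step_alice (hZpos _ (by omega)) hY hEp hU h1 hEψ⟩

/-- Bob's operators along the rounds, from the certificate against cheating Alice. -/
lemma exists_steps_bob (hP : P.IsPenWCF) {Λ r : ℝ≥0} (hr : P.cheatingRewardA Λ < r) :
    ∃ Z : ℕ → Matrix B B ℂ, Z P.n = P.rewardOpB Λ ∧
      (∀ i ≤ P.n, (Z i).PosSemidef) ∧ (∀ i < P.n, Even i → Z (i + 1) = Z i) ∧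
      (∀ i < P.n, Odd i → ∀ X : Matrix A A ℂ, X.PosSemidef → ∃ E,
        Step (onAB M (1 : Matrix A A ℂ) (Z (i + 1))) (onAB M (1 : Matrix A A ℂ) (Z i))
          (onAB M X (1 : Matrix B B ℂ)) (P.U (i + 1)) E (P.honest i)) ∧
      ∀ X : Matrix A A ℂ, X.PosSemidef → ∃ E,
        Step (onAB M (1 : Matrix A A ℂ) (Z 0)) (((r : ℝ) : ℂ) • 1)
          (onAB M X (1 : Matrix B B ℂ)) 1 E (P.honest 0) := by
  obtain ⟨m, hm⟩ : ∃ m, P.n = 2 * m := by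
    obtain ⟨k, hk⟩ := hP.even_n
    exact ⟨k, by omega⟩
  obtain ⟨Z, hZm, hZpos, hZ0, hZ⟩ := exists_dual_bob hP hr hm
  refine ⟨fun i => Z (i / 2), ?_, fun i hi => hZpos _ (by omega), ?_, ?_, ?_⟩
  · simp only
    rw [hm, show (2 * m) / 2 = m by omega, hZm]
  · rintro i hi ⟨k, rfl⟩
    simp only
    congr 1
    omega
  · rintro i hi ⟨j, rfl⟩ X hX
    have hev : Even (2 * j + 1 + 1) := ⟨j + 1, by ring⟩
    have hodd : ¬ Odd (2 * j + 1 + 1) := Nat.not_odd_iff_even.2 hev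
    have hU := hP.unitary_UB _ (by omega) (by omega) hev
    have hEp := hP.proj_EB _ (by omega) (by omega) hev
    have hEψ := hP.honest_E _ hi
    rw [E, if_neg hodd] at hEψ
    rw [U, if_neg hodd]
    have h1 := hZ j (by omega)
    rw [conjTranspose_mul_proj_mul hEp] at h1
    simp only
    rw [show (2 * j + 1 + 1) / 2 = j + 1 by omega, show (2 * j + 1) / 2 = j by omega]
    exact ⟨_, step_bob (hZpos _ (by omega)) hX hEp hU h1 hEψ⟩
  -- An additional step with trivial unitary and check `|ψ_B⟩⟨ψ_B|`, turning Bob's initial operator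
  -- into the scalar `r`.
  · intro X hX
    have hp := isStarProjection_ketbra hP.norm_psiB
    have hkk : ketbra P.psiB * ketbra P.psiB = ketbra P.psiB := hp.isIdempotentElem
    have hpM : IsStarProjection ((1 : Matrix M M ℂ) ⊗ₖ ketbra P.psiB) := by
      refine ⟨?_, ((PosSemidef.one (n := M)).kronecker (ketbra_posSemidef P.psiB)).1⟩
      rw [IsIdempotentElem, ← mul_kronecker_mul, hkk, Matrix.one_mul]
    have h1 := smul_one_sub_ketbra_posDef hP.norm_psiB (hZpos 0 (by omega)) hZ0
    have h2 := step_bob (Z := ((r : ℝ) : ℂ) • 1) (hZpos 0 (by omega)) hX hpM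
      (one_mem (unitaryGroup (M × B) ℂ)) (by
        have h3 := (PosDef.one (n := M) (R := ℂ)).kronecker h1
        rw [conjTranspose_one, Matrix.one_mul, Matrix.mul_one, ← mul_kronecker_mul,
          ← mul_kronecker_mul, Matrix.one_mul, Matrix.one_mul]
        convert! h3 using 1
        ext; simp [mul_sub]) (ψ := P.honest 0) (by
        rw [onMB_mulVec_honest_zero, ketbra_mulVec hP.norm_psiB]; rfl)
    rw [onMB_one] at h2
    have h3 : onAB M (1 : Matrix A A ℂ) (((r : ℝ) : ℂ) • (1 : Matrix B B ℂ)) =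
        ((r : ℝ) : ℂ) • 1 := by
      simp only [onAB, kronecker_smul, one_kronecker_one]
    rw [h3] at h2
    exact ⟨_, h2⟩

lemma sqNorm_honest_zero (hP : P.IsPenWCF) : sqNorm (P.honest 0) = 1 := by
  have h1 := sqNorm_psiA_psiM hP
  have h2 := hP.norm_psiB
  rw [sqNorm] at h1 h2 ⊢
  have h3 := congrArg₂ (· * ·) h1 h2
  simp only [Finset.sum_mul_sum, mul_one] at h3
  rw [← Equiv.sum_comp (Equiv.prodAssoc A M B), Fintype.sum_prod_type]
  simpa [honest, mul_pow] using h3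

lemma cheatingRewardA_nonneg (hP : P.IsPenWCF) (Λ : ℝ≥0) : 0 ≤ P.cheatingRewardA Λ := by
  refine Real.sSup_nonneg ?_
  rintro _ ⟨W, _, _, S, rfl⟩
  rw [aliceReward_eq]
  exact trace_mul_re_nonneg (PosSemidef.one.kronecker (PosSemidef.one.kronecker
    (combination_posSemidef hP.povm_B Λ 0 1))) (aliceCheatState_bound hP S _ le_rfl).1

lemma cheatingRewardB_nonneg (hP : P.IsPenWCF) (Λ : ℝ≥0) : 0 ≤ P.cheatingRewardB Λ := by
  refine Real.sSup_nonneg ?_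
  rintro _ ⟨W, _, _, S, rfl⟩
  rw [bobReward_eq]
  exact trace_mul_re_nonneg ((combination_posSemidef hP.povm_A Λ 1 0).kronecker
    (PosSemidef.one.kronecker PosSemidef.one)) (bobCheatState_bound hP S _ le_rfl).1

lemma star_dotProduct_self_honest_zero (hP : P.IsPenWCF) (r : ℝ) :
    (star (P.honest 0) ⬝ᵥ ((r : ℂ) • (1 : Matrix (A × M × B) (A × M × B) ℂ)) *ᵥ P.honest 0).re =
      r := by
  rw [smul_mulVec, one_mulVec, dotProduct_smul, dotProduct_comm, ← trace_vecMulVec, ← ketbra,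
    trace_ketbra, sqNorm_honest_zero hP]
  simp

end Protocol

open Protocol in
/-- For every protocol and every `β`, `α` strictly above the cheating rewards there is a point game
with final point `⟦β, α⟧`. -/
theorem exists_isPenEBMPointGame {A M B : Type} [Fintype A] [DecidableEq A] [Fintype M]
    [DecidableEq M] [Fintype B] [DecidableEq B] {Λ : ℝ≥0} {P : Protocol A M B} (hP : P.IsPenWCF)
    {β α : ℝ≥0} (hβ : P.cheatingRewardA Λ < β) (hα : P.cheatingRewardB Λ < α) :
    ∃ (n : ℕ) (p : ℕ → Frame), IsPenEBMPointGame Λ n p β α := by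
  obtain ⟨ZA, hZAn, hZA0, hZA, hZAconst, hstepA⟩ := exists_steps_alice hP hα
  obtain ⟨ZB, hZBn, hZB, hZBconst, hstepB, hstep0⟩ := exists_steps_bob hP hβ
  set X : ℕ → Matrix (A × M × B) (A × M × B) ℂ := fun i => onAB M 1 (ZB i) with hX
  set Y : ℕ → Matrix (A × M × B) (A × M × B) ℂ := fun i => onAB M (ZA i) 1 with hY
  obtain ⟨hfin, hfinX, hfinY⟩ := honest_final hP Λ
  rw [← hZAn, ← hZBn] at hfin
  rw [← hZBn] at hfinX
  rw [← hZAn] at hfinY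
  have hXY : ∀ i j, X i * Y j = Y j * X i := fun i j => (onAB_comm _ _).symm
  have hXpos : ∀ i ≤ P.n, (X i).PosSemidef := fun i hi =>
    PosSemidef.one.kronecker (PosSemidef.one.kronecker (hZB i hi))
  have hYpos : ∀ i ≤ P.n, (Y i).PosSemidef := fun i hi =>
    (hZA i hi).kronecker (PosSemidef.one.kronecker PosSemidef.one)
  have hA : ∀ i < P.n, Even i → X (i + 1) = X i ∧
      ∃ E, Step (Y (i + 1)) (Y i) (X i) (P.U (i + 1)) E (P.honest i) := fun i hi he =>
    ⟨by simp only [hX, hZBconst i hi he], hstepA i hi he _ (hZB i hi.le)⟩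
  have hB : ∀ i < P.n, Odd i → Y (i + 1) = Y i ∧
      ∃ E, Step (X (i + 1)) (X i) (Y i) (P.U (i + 1)) E (P.honest i) := fun i hi ho =>
    ⟨by simp only [hY, hZAconst i hi ho], hstepB i hi ho _ (hZA i hi.le)⟩
  obtain ⟨E₀, hE₀⟩ := hstep0 _ (hZA 0 (Nat.zero_le _))
  have hY0 : Y 0 = ((α : ℝ) : ℂ) • 1 := by
    simp only [hY, hZA0, onAB, smul_kronecker, one_kronecker_one]
  -- Backwards from the honest value `Λ + 1/2` at time `n`, each round preserves one expectation and
  -- does not lower the other.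
  have hexp : ∀ i ≤ P.n, (Λ + 1 / 2 : ℝ) ≤ (star (P.honest i) ⬝ᵥ X i *ᵥ P.honest i).re ∧
      (Λ + 1 / 2 : ℝ) ≤ (star (P.honest i) ⬝ᵥ Y i *ᵥ P.honest i).re := by
    intro i hi
    induction hi using Nat.decreasingInduction with
    | self => exact ⟨hfinX.ge, hfinY.ge⟩
    | of_succ k hk ih =>
      rcases Nat.even_or_odd k with he | ho
      · obtain ⟨hc, E, hE⟩ := hA k hk he
        rw [hc] at ih
        exact ⟨ih.1.trans_eq (congrArg Complex.re hE.expect_eq), ih.2.trans hE.expect_le⟩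
      · obtain ⟨hc, E, hE⟩ := hB k hk ho
        rw [hc] at ih
        exact ⟨ih.1.trans hE.expect_le, ih.2.trans_eq (congrArg Complex.re hE.expect_eq)⟩
  obtain ⟨hexpX, hexpY⟩ := hexp 0 (Nat.zero_le _)
  have hΛα : Λ ≤ α := by
    rw [hY0, star_dotProduct_self_honest_zero hP] at hexpY
    exact NNReal.coe_le_coe.1 (by linarith)
  have hΛβ : Λ ≤ β := by
    have h1 := hE₀.expect_le
    rw [star_dotProduct_self_honest_zero hP, one_mulVec] at h1
    exact NNReal.coe_le_coe.1 (by linarith)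
  set F : ℕ → Frame := fun i => frame (X i) (Y i) (WithLp.toLp 2 (P.honest i)) with hF
  -- Time is reversed and `F n` occurs twice. The game must open with a vertical transition, while
  -- round `n` is Bob's and hence horizontal, so the first transition is trivial. The last one, of
  -- odd index `n + 1`, is the additional step of Bob.
  set p : ℕ → Frame := fun i =>
    if i = 0 then F P.n else if i ≤ P.n + 1 then F (P.n + 1 - i) else point 1 β α with hp
  have hpF : ∀ k ≤ P.n, p (P.n + 1 - k) = F k := by
    intro k hk
    simp only [hp]
    rw [if_neg (by omega), if_pos (by omega)]
    congr 1
    omega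
  refine ⟨P.n + 2, p, ?_, ?_, ?_, ?_, hΛβ, hΛα⟩
  · simp only [hp, if_true]
    exact hfin
  · intro i hi he
    rcases Nat.eq_zero_or_pos i with rfl | hpos
    · have h1 : p (0 + 1) = p 0 := by simp [hp]
      rw [h1]
      exact isEBMVertical_refl (hXpos _ le_rfl).1 (hYpos _ le_rfl) (hXY _ _) _
    · have hn := hP.even_n
      obtain ⟨k, hk⟩ : ∃ k, P.n = k + i := ⟨P.n - i, by
        have : i ≠ P.n + 1 := by rintro rfl; exact (Nat.not_even_iff_odd.2 hn.add_one) he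
        omega⟩
      have hke : Even k := by rw [hk, Nat.even_add] at hn; exact hn.2 he
      rw [show i = P.n + 1 - (k + 1) by omega, hpF _ (by omega),
        show P.n + 1 - (k + 1) + 1 = P.n + 1 - k by omega, hpF _ (by omega)]
      obtain ⟨hc, E, hE⟩ := hA k (by omega) hke
      have := hE.isEBMVertical (hXY _ _) (hXY _ _)
      simp only [hF]
      rw [hc]
      exact this
  · intro i hi ho
    have hn := hP.even_n
    rcases (show i ≤ P.n + 1 by omega).eq_or_lt with rfl | hlt
    · have h1 : p (P.n + 1 + 1) = point 1 β α := by simp [hp]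
      have h2 := hpF 0 (Nat.zero_le _)
      rw [Nat.sub_zero] at h2
      rw [h1, h2, ← frame_of_eigenvector (X := ((β : ℝ) : ℂ) • 1) hE₀.isHermitian_left
        (hYpos 0 (Nat.zero_le _)).1 (v := P.honest 0) (by rw [smul_mulVec, one_mulVec])
        (by rw [hY0, smul_mulVec, one_mulVec]) (sqNorm_honest_zero hP)]
      have := hE₀.isEBMHorizontal
      rw [one_mulVec] at this
      exact this
    · obtain ⟨k, hk⟩ : ∃ k, P.n = k + i := ⟨P.n - i, by omega⟩
      have hko : Odd k := by
        rw [← Nat.not_even_iff_odd] at ho ⊢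
        intro hk'; rw [hk, Nat.even_add] at hn; exact ho (hn.1 hk')
      have hpos : 0 < i := ho.pos
      rw [show i = P.n + 1 - (k + 1) by omega, hpF _ (by omega),
        show P.n + 1 - (k + 1) + 1 = P.n + 1 - k by omega, hpF _ (by omega)]
      obtain ⟨hc, E, hE⟩ := hB k (by omega) hko
      have := hE.isEBMHorizontal
      simp only [hF]
      rw [hc]
      exact this
  · simp [hp]

end PenWCF

theorem mainTheorem6 {A M B : Type} [Fintype A] [DecidableEq A] [Fintype M] [DecidableEq M]
    [Fintype B] [DecidableEq B] (Λ : ℝ≥0) (P : PenWCF.Protocol A M B) (hP : P.IsPenWCF)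
    (δ : ℝ) (hδ : 0 < δ) :
    ∃ β α : ℝ≥0, (β : ℝ) = P.cheatingRewardA Λ + δ ∧ (α : ℝ) = P.cheatingRewardB Λ + δ ∧
      ∃ (n : ℕ) (p : ℕ → PenWCF.Frame), PenWCF.IsPenEBMPointGame Λ n p β α := by
  -- Nonnegativity of the rewards makes the final coordinates elements of `ℝ≥0`.
  have hA := PenWCF.Protocol.cheatingRewardA_nonneg hP Λ
  have hB := PenWCF.Protocol.cheatingRewardB_nonneg hP Λ
  refine ⟨⟨P.cheatingRewardA Λ + δ, by linarith⟩, ⟨P.cheatingRewardB Λ + δ, by linarith⟩, rfl, rfl,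
    PenWCF.exists_isPenEBMPointGame hP ?_ ?_⟩
  · exact lt_add_of_pos_right _ hδ
  · exact lt_add_of_pos_right _ hδ
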